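/- Let $R$ be a commutative ring, let $\mathrm{FI}$ be the category of finite sets and injective maps, and call a functor from $\mathrm{FI}$ to $R$-modules an $\mathrm{FI}$-module. For an $\mathrm{FI}$-module $V$ let $JV\subseteq V$ be the submodule whose value at a finite set $X$ is spanned by the elements $\alpha(v)$ with $\alpha\colon Y\to X$ injective, $|Y|<|X|$ and $v\in V(Y)$. For $a\ge 0$ let the $\mathrm{FI}$-homology $H^{\mathrm{FI}}_a$ be the $a$-th left derived functor of the right exact functor $V\mapsto V/JV$ from the category of $\mathrm{FI}$-modules to itself. For an $\mathrm{FI}$-module $V$ let $\widetilde S_{-*}V$ be the complex of $\mathrm{FI}$-modules $\cdots\to\widetilde S_{-2}V\to\widetilde S_{-1}V\to\widetilde S_0V\to 0$ with $$(\widetilde S_{-a}V)(X)=\bigoplus_{I\subseteq X,\ |I|=a}V(X\setminus I)\otimes_R\det(I),\qquad \det(I)=\textstyle\bigwedge^{|I|}RI,$$ where $RI$ is the free $R$-module with basis $I$, with differential $$d(v\otimes i_1\wedge\cdots\wedge i_a)=\sum_{p=1}^a(-1)^p\,i_p(v)\otimes i_1\wedge\cdots\widehat{i_p}\cdots\wedge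 i_a,$$ where $I=\{i_1,\dots,i_a\}$, $v\in V(X\setminus I)$ and $i_p(v)$ is the image of $v$ under the inclusion $X\setminus I\subset (X\setminus I)\cup\{i_p\}$, and where an injection $\alpha\colon X\to X'$ acts by $\alpha(v\otimes i_1\wedge\cdots\wedge i_a)=\alpha(v)\otimes\alpha(i_1)\wedge\cdots\wedge\alpha(i_a)$. **Theorem.** For every commutative ring $R$, every $\mathrm{FI}$-module $V$ over $R$ and every $a\ge 0$ there is an isomorphism of $\mathrm{FI}$-modules $$H^{\mathrm{FI}}_a(V)\cong H_a(\widetilde S_{-*}V),$$ natural in $V$. -/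

import Mathlib

open CategoryTheory TensorProduct

universe u

/-- A finite set, as an object of the category `FI`. -/
structure FI : Type 1 where
  carrier : Type
  [finite : Finite carrier]

namespace FI

instance : CoeSort FI Type := ⟨FI.carrier⟩

instance (X : FI) : Finite X := X.finite

/-- A morphism of `FI` is an injective map. -/
@[ext]
structure Hom (X Y : FI) where
  toFun : X → Y
  injective : Function.Injective toFun

/-- The category of finite sets and injective maps. -/
instance : Category FI where
  Hom := Hom
  id X := ⟨id, Function.injective_id⟩
  comp f g := ⟨g.toFun ∘ f.toFun, g.injective.comp f.injective⟩

@[ext]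
theorem hom_ext {X Y : FI} {f g : X ⟶ Y} (h : ∀ x, f.toFun x = g.toFun x) : f = g :=
  Hom.ext (funext h)

@[simp]
theorem id_toFun (X : FI) (x : X) : Hom.toFun (𝟙 X) x = x := rfl

@[simp]
theorem comp_toFun {X Y Z : FI} (f : X ⟶ Y) (g : Y ⟶ Z) (x : X) :
    Hom.toFun (f ≫ g) x = g.toFun (f.toFun x) := rfl

/-- The standard finite set with `n` elements. -/
def std (n : ℕ) : FI := ⟨Fin n⟩

/-- The complement of a subset of a finite set. -/
def compl {X : FI} (I : Set X) : FI := ⟨(Iᶜ : Set X)⟩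

/-- The inclusion of complements induced by an inclusion of subsets. -/
def complIncl {X : FI} {I K : Set X} (h : K ⊆ I) : compl I ⟶ compl K :=
  ⟨fun x => ⟨x.1, fun hx => x.2 (h hx)⟩, fun _ _ e => Subtype.ext (congrArg (fun z => z.1) e)⟩

/-- The map `X ∖ I → Y ∖ α(I)` obtained by restricting an injection `α : X → Y`. -/
def complMap {X Y : FI} (α : X ⟶ Y) (I : Set X) : compl I ⟶ compl (α.toFun '' I) :=
  ⟨fun x => ⟨α.toFun x.1, fun ⟨_, hz, e⟩ => x.2 (α.injective e ▸ hz)⟩,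
    fun _ _ e => Subtype.ext (α.injective (congrArg (fun z => z.1) e))⟩

@[simp]
theorem complIncl_coe {X : FI} {I K : Set X} (h : K ⊆ I) (x : compl I) :
    ((complIncl h).toFun x).1 = x.1 := rfl

@[simp]
theorem complMap_coe {X Y : FI} (α : X ⟶ Y) (I : Set X) (x : compl I) :
    ((complMap α I).toFun x).1 = α.toFun x.1 := rfl

end FI

/-- `FI`-modules over `R`: functors from `FI` to `R`-modules. -/
abbrev FIModule (R : Type u) [CommRing R] := FI ⥤ ModuleCat.{u} R

noncomputable section

namespace FIModule

variable {R : Type u} [CommRing R]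

theorem map_map_apply (V : FIModule R) {X Y Z : FI} (f : X ⟶ Y) (g : Y ⟶ Z) (v : V.obj X) :
    V.map g (V.map f v) = V.map (f ≫ g) v := by
  rw [V.map_comp]; rfl

theorem app_map_apply {V W : FIModule R} (η : V ⟶ W) {X Y : FI} (f : X ⟶ Y) (v : V.obj X) :
    η.app Y (V.map f v) = W.map f (η.app X v) :=
  ConcreteCategory.congr_hom (η.naturality f) v

/-! ### Free modules and enough projectives -/

/-- The free `FI`-module `M(d)`, sending `X` to the free `R`-module on the injections
from a set with `d` elements to `X`. -/
def free (R : Type u) [CommRing R] (d : ℕ) : FIModule R where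
  obj X := ModuleCat.of R ((FI.std d ⟶ X) →₀ R)
  map f := ModuleCat.ofHom (Finsupp.lmapDomain R R (fun α => α ≫ f))
  map_id X := by
    ext : 1
    refine Finsupp.lhom_ext' fun α => LinearMap.ext_ring ?_
    simp
  map_comp f g := by
    ext : 1
    refine Finsupp.lhom_ext' fun α => LinearMap.ext_ring ?_
    simp

/-- The morphism `M(d) ⟶ V` determined by an element of `V` at the set with `d` elements. -/
def freeLift (V : FIModule R) (d : ℕ) (v : V.obj (FI.std d)) : free R d ⟶ V where
  app X := ModuleCat.ofHom (Finsupp.linearCombination R (fun α : FI.std d ⟶ X => V.map α v))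
  naturality X Y f := by
    ext : 1
    refine Finsupp.lhom_ext' fun α => LinearMap.ext_ring ?_
    simp [free]

/-- The basis element of `M(d)(X)` given by an injection. -/
def freeGen (R : Type u) [CommRing R] {d : ℕ} {X : FI} (α : FI.std d ⟶ X) : (free R d).obj X :=
  Finsupp.single α (1 : R)

theorem free_map_freeGen {d : ℕ} {X Y : FI} (α : FI.std d ⟶ X) (f : X ⟶ Y) :
    (free R d).map f (freeGen R α) = freeGen R (α ≫ f) :=
  Finsupp.mapDomain_single

theorem freeLift_freeGen (V : FIModule R) (d : ℕ) (v : V.obj (FI.std d)) {X : FI}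
    (α : FI.std d ⟶ X) : (freeLift V d v).app X (freeGen R α) = V.map α v :=
  (Finsupp.linearCombination_single R 1 α).trans (one_smul R _)

theorem free_hom_ext {V : FIModule R} {d : ℕ} {f g : free R d ⟶ V}
    (h : f.app _ (freeGen R (𝟙 (FI.std d))) = g.app _ (freeGen R (𝟙 (FI.std d)))) : f = g := by
  ext X : 3
  refine Finsupp.lhom_ext' fun α => LinearMap.ext_ring ?_
  have key : ∀ k : free R d ⟶ V, k.app X (freeGen R α) =
      V.map α (k.app _ (freeGen R (𝟙 (FI.std d)))) := by
    intro k
    rw [← app_map_apply, free_map_freeGen, Category.id_comp]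
  exact (key f).trans ((congrArg _ h).trans (key g).symm)

instance free_projective (d : ℕ) : Projective (free R d) where
  factors {E W} f e _ := by
    have hs : Function.Surjective (e.app (FI.std d)) :=
      (ModuleCat.epi_iff_surjective _).1 inferInstance
    obtain ⟨v, hv⟩ := hs (f.app _ (freeGen R (𝟙 (FI.std d))))
    refine ⟨freeLift E d v, free_hom_ext ?_⟩
    rw [NatTrans.comp_app, ModuleCat.comp_apply, freeLift_freeGen, ← hv, E.map_id]
    rfl

open Limits in
instance : EnoughProjectives (FIModule R) where
  presentation V := by
    let F : (Σ n : ℕ, V.obj (FI.std n)) → FIModule R := fun s => free R s.1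
    let π : (∐ F) ⟶ V := Sigma.desc fun s => freeLift V s.1 s.2
    have hF : ∀ s, Projective (F s) := fun s => free_projective s.1
    have hπ : ∀ X, Epi (π.app X) := by
      intro X
      rw [ModuleCat.epi_iff_surjective]
      intro w
      obtain ⟨n, ⟨e⟩⟩ := Finite.exists_equiv_fin X
      let α : FI.std n ⟶ X := ⟨e.symm, e.symm.injective⟩
      let β : X ⟶ FI.std n := ⟨e, e.injective⟩
      have hβα : β ≫ α = 𝟙 X := FI.hom_ext fun x => e.symm_apply_apply x
      let s : Σ n : ℕ, V.obj (FI.std n) := ⟨n, V.map β w⟩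
      have hs : Sigma.ι F s ≫ π = freeLift V n (V.map β w) := Sigma.ι_desc _ _
      refine ⟨(Sigma.ι F s).app X (freeGen R α), ?_⟩
      change (Sigma.ι F s ≫ π).app X (freeGen R α) = w
      rw [hs, freeLift_freeGen, map_map_apply, hβα, V.map_id]
      rfl
    have hp : Projective (∐ F) :=
      { factors f e _ :=
          ⟨Sigma.desc fun s => Projective.factorThru (Sigma.ι F s ≫ f) e,
            Sigma.hom_ext _ _ fun s => by
              rw [← Category.assoc, Sigma.ι_desc, Projective.factorThru_comp]⟩ }
    exact ⟨{ p := ∐ F, f := π, projective := hp, epi := NatTrans.epi_of_epi_app π }⟩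

/-! ### The functor `V ↦ V / JV` and `FI`-homology -/

/-- The value at `X` of `JV`: the submodule of `V(X)` spanned by the images of all maps `V(α)`,
where `α` is an injection into `X` from a set with fewer elements. -/
def J (V : FIModule R) (X : FI) : Submodule R (V.obj X) :=
  Submodule.span R {w | ∃ (Y : FI) (α : Y ⟶ X) (v : V.obj Y),
    Nat.card Y < Nat.card X ∧ V.map α v = w}

theorem J_le_comap_map (V : FIModule R) {X X' : FI} (f : X ⟶ X') :
    J V X ≤ (J V X').comap (V.map f).hom := by
  refine Submodule.span_le.2 ?_
  rintro _ ⟨Y, α, v, hY, rfl⟩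
  refine Submodule.subset_span ⟨Y, α ≫ f, v,
    hY.trans_le (Nat.card_le_card_of_injective _ f.injective), ?_⟩
  exact (map_map_apply V α f v).symm

theorem J_le_comap_app {V W : FIModule R} (η : V ⟶ W) (X : FI) :
    J V X ≤ (J W X).comap (η.app X).hom := by
  refine Submodule.span_le.2 ?_
  rintro _ ⟨Y, α, v, hY, rfl⟩
  exact Submodule.subset_span ⟨Y, α, η.app Y v, hY, (app_map_apply η α v).symm⟩

/-- The `FI`-module `V / JV`. -/
def modJ (V : FIModule R) : FIModule R where
  obj X := ModuleCat.of R (V.obj X ⧸ J V X)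
  map f := ModuleCat.ofHom (Submodule.mapQ _ _ (V.map f).hom (J_le_comap_map V f))
  map_id X := by
    ext : 1
    refine Submodule.linearMap_qext _ (LinearMap.ext fun v => ?_)
    simp
  map_comp f g := by
    ext : 1
    refine Submodule.linearMap_qext _ (LinearMap.ext fun v => ?_)
    simp

/-- The functor `V ↦ V / JV` from `FI`-modules to `FI`-modules. -/
def modJFunctor (R : Type u) [CommRing R] : FIModule R ⥤ FIModule R where
  obj V := modJ V
  map η :=
    { app X := ModuleCat.ofHom (Submodule.mapQ _ _ (η.app X).hom (J_le_comap_app η X))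
      naturality X Y f := by
        ext : 1
        refine Submodule.linearMap_qext _ (LinearMap.ext fun v => ?_)
        exact congrArg (Submodule.Quotient.mk (p := J _ _)) (app_map_apply η f v) }
  map_id V := by
    ext X : 3
    refine Submodule.linearMap_qext _ (LinearMap.ext fun v => ?_)
    rfl
  map_comp η θ := by
    ext X : 3
    refine Submodule.linearMap_qext _ (LinearMap.ext fun v => ?_)
    rfl

instance : (modJFunctor R).Additive where
  map_add {V W f g} := by
    ext X : 3
    refine Submodule.linearMap_qext _ (LinearMap.ext fun v => ?_)
    rfl

/-- `FI`-homology: the `a`-th left derived functor of `V ↦ V / JV`. -/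
def homology (R : Type u) [CommRing R] (a : ℕ) : FIModule R ⥤ FIModule R :=
  (modJFunctor R).leftDerived a

/-! ### The Koszul complex -/

/-- The subsets of `X` with `a` elements. -/
@[ext]
structure Index (X : FI) (a : ℕ) : Type where
  set : Set X
  card : set.ncard = a

instance (X : FI) (a : ℕ) : DecidableEq (Index X a) := Classical.decEq _

/-- For a finite set `I` with `a` elements, the module `det I`: the top exterior power of the free
`R`-module with basis `I`. -/
abbrev Det (R : Type u) [CommRing R] {X : FI} {a : ℕ} (I : Index X a) : Type u :=
  ⋀[R]^a (I.set →₀ R)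

/-- The summand `V(X ∖ I) ⊗ det I`. -/
abbrev Summand (V : FIModule R) {X : FI} {a : ℕ} (I : Index X a) : Type u :=
  V.obj (FI.compl I.set) ⊗[R] Det R I

/-- The module in homological degree `a` of the Koszul complex at `X`: the direct sum of the
`V(X ∖ I) ⊗ det I` over all subsets `I` of `X` with `a` elements. -/
abbrev KoszulTerm (V : FIModule R) (X : FI) (a : ℕ) : Type u :=
  DirectSum (Index X a) fun I => Summand V I

/-- The basis vector of `RI` given by an element of `I`. -/
def vec (R : Type u) [CommRing R] {X : FI} {I : Set X} (i : I) : I →₀ R := Finsupp.single i 1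

/-- The element `v ⊗ f 0 ∧ ⋯ ∧ f (a - 1)` of the summand indexed by `I`, where `f` is a
sequence of elements of `I`. -/
def gen (V : FIModule R) {X : FI} {a : ℕ} (I : Index X a) (f : Fin a → I.set)
    (v : V.obj (FI.compl I.set)) : KoszulTerm V X a :=
  DirectSum.lof R (Index X a) (fun I => Summand V I) I
    (v ⊗ₜ[R] exteriorPower.ιMulti R a (fun p => vec R (f p)))

theorem koszulTerm_hom_ext {V : FIModule R} {X : FI} {a : ℕ} {N : Type*} [AddCommGroup N]
    [Module R N] {φ ψ : KoszulTerm V X a →ₗ[R] N}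
    (h : ∀ (I : Index X a) (f : Fin a → I.set), Function.Injective f →
      ∀ v, φ (gen V I f v) = ψ (gen V I f v)) : φ = ψ := by
  refine DirectSum.linearMap_ext R fun I => TensorProduct.ext' fun v w => ?_
  suffices H : (φ ∘ₗ DirectSum.lof R _ _ I) ∘ₗ TensorProduct.mk R _ (Det R I) v =
      (ψ ∘ₗ DirectSum.lof R _ _ I) ∘ₗ TensorProduct.mk R _ (Det R I) v from
    LinearMap.congr_fun H w
  refine exteriorPower.linearMap_ext ?_
  refine Module.Basis.ext_alternating (Finsupp.basisSingleOne (R := R) (ι := I.set)) ?_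
  intro f hf
  simpa [gen, vec] using h I f hf v

theorem gen_congr (V : FIModule R) {X T : FI} {a : ℕ} {I I' : Index X a} (hI : I.set = I'.set)
    {f : Fin a → I.set} {f' : Fin a → I'.set} (hf : ∀ p, (f p).1 = (f' p).1)
    {g : T ⟶ FI.compl I.set} {g' : T ⟶ FI.compl I'.set} (hg : ∀ t, (g.toFun t).1 = (g'.toFun t).1)
    (v : V.obj T) : gen V I f (V.map g v) = gen V I' f' (V.map g' v) := by
  obtain rfl : I = I' := Index.ext hI
  obtain rfl : f = f' := funext fun p => Subtype.ext (hf p)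
  obtain rfl : g = g' := FI.hom_ext fun t => Subtype.ext (hg t)
  rfl

/-- Removing an element from a set of cardinality `a + 1`. -/
abbrev Index.erase {X : FI} {a : ℕ} (I : Index X (a + 1)) (i : I.set) : Index X a :=
  ⟨I.set \ {i.1}, by rw [Set.ncard_sdiff_singleton_of_mem i.2, I.card, Nat.add_sub_cancel]⟩

/-- The image of a set of cardinality `a` under an injection. -/
abbrev Index.image {X Y : FI} {a : ℕ} (α : X ⟶ Y) (I : Index X a) : Index Y a :=
  ⟨α.toFun '' I.set, by rw [Set.ncard_image_of_injective _ α.injective, I.card]⟩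

/-- The restriction map `RI → R(I ∖ {i})` forgetting the coordinate `i`. -/
def restrict (R : Type u) [CommRing R] {X : FI} {a : ℕ} (I : Index X (a + 1)) (i : I.set) :
    (I.set →₀ R) →ₗ[R] ((I.erase i).set →₀ R) :=
  Finsupp.lcomapDomain (fun x => ⟨x.1, x.2.1⟩)
    (fun _ _ e => Subtype.ext (congrArg (fun z => z.1) e))

/-- The contraction `det I → det (I ∖ {i})` with the coordinate `i`:
it sends `x₁ ∧ ⋯ ∧ xₐ` to the sum over `p` of `(-1) ^ p` times the `i`-th coordinate of `xₚ` times
the wedge product of the remaining vectors. In particular, for `I = {i₁, …, iₐ}`, contraction with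
`iₚ` sends `i₁ ∧ ⋯ ∧ iₐ` to `(-1) ^ p` times the wedge product with `iₚ` omitted. -/
def contract (R : Type u) [CommRing R] {X : FI} {a : ℕ} (I : Index X (a + 1)) (i : I.set) :
    Det R I →ₗ[R] Det R (I.erase i) :=
  -exteriorPower.alternatingMapLinearEquiv
    (AlternatingMap.alternatizeUncurryFin
      ((Finsupp.lapply (R := R) i).smulRight
        ((exteriorPower.ιMulti R a).compLinearMap (restrict R I i))))

theorem contract_ιMulti {X : FI} {a : ℕ} (I : Index X (a + 1)) (i : I.set)
    (x : Fin (a + 1) → (I.set →₀ R)) :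
    contract R I i (exteriorPower.ιMulti R (a + 1) x) =
      ∑ p : Fin (a + 1), (-1 : R) ^ (p.val + 1) • x p i •
        exteriorPower.ιMulti R a (fun q => restrict R I i (x (p.succAbove q))) := by
  rw [contract, LinearMap.neg_apply, exteriorPower.alternatingMapLinearEquiv_apply_ιMulti,
    AlternatingMap.alternatizeUncurryFin_apply, ← Finset.sum_neg_distrib]
  refine Finset.sum_congr rfl fun p _ => ?_
  rw [pow_succ, mul_neg_one, neg_smul (M := Det R (I.erase i))]
  rcases Nat.even_or_odd p.val with h | h <;> simp only [h.neg_one_pow, one_smul, neg_smul] <;> rfl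

/-- The inclusion `X ∖ I → (X ∖ I) ∪ {i} = X ∖ (I ∖ {i})`, for `i ∈ I`. -/
def insertIncl {X : FI} {a : ℕ} (I : Index X (a + 1)) (i : I.set) :
    FI.compl I.set ⟶ FI.compl (I.erase i).set :=
  FI.complIncl Set.sdiff_subset

/-- The differential of the Koszul complex at `X`, from degree `a + 1` to degree `a`; on the
summand indexed by `I` it is the sum over `i ∈ I` of the tensor product of the map
`V(X ∖ I) → V((X ∖ I) ∪ {i})` with the contraction `det I → det (I ∖ {i})`. -/
def koszulD (V : FIModule R) (X : FI) (a : ℕ) : KoszulTerm V X (a + 1) →ₗ[R] KoszulTerm V X a :=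
  DirectSum.toModule R _ _ fun I =>
    letI : Fintype I.set := Fintype.ofFinite _
    ∑ i : I.set, DirectSum.lof R (Index X a) (fun K => Summand V K) (I.erase i) ∘ₗ
      TensorProduct.map (V.map (insertIncl I i)).hom (contract R I i)

/-- The differential on `v ⊗ f 0 ∧ ⋯ ∧ f a`; since `p` is counted from `0` here, the `p`-th sign
is `(-1) ^ (p + 1)`. -/
theorem koszulD_gen (V : FIModule R) {X : FI} {a : ℕ} (I : Index X (a + 1))
    (f : Fin (a + 1) → I.set) (hf : Function.Injective f) (v : V.obj (FI.compl I.set)) :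
    koszulD V X a (gen V I f v) =
      ∑ p : Fin (a + 1), (-1 : R) ^ (p.val + 1) •
        gen V (I.erase (f p))
          (fun q => ⟨(f (p.succAbove q)).1, (f (p.succAbove q)).2,
            fun e => p.succAbove_ne q (hf (Subtype.ext e))⟩)
          (V.map (insertIncl I (f p)) v) := by
  classical
  let _ : Fintype I.set := Fintype.ofFinite _
  have hcard : Fintype.card (Fin (a + 1)) = Fintype.card I.set := by
    rw [Fintype.card_fin, ← Nat.card_eq_fintype_card, Nat.card_coe_set_eq, I.card]
  have hbij : Function.Bijective f := (Fintype.bijective_iff_injective_and_card f).2 ⟨hf, hcard⟩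
  have hvec : ∀ p q, vec R (f q) (f p) = if q = p then (1 : R) else 0 := by
    intro p q
    rw [vec, Finsupp.single_apply]
    exact if_congr hf.eq_iff rfl rfl
  rw [gen, koszulD, DirectSum.toModule_lof, LinearMap.sum_apply, ← hbij.sum_comp]
  refine Finset.sum_congr rfl fun p _ => ?_
  rw [LinearMap.comp_apply, TensorProduct.map_tmul, contract_ιMulti,
    Finset.sum_eq_single p (fun q _ hq => by rw [hvec, if_neg hq, zero_smul, smul_zero])
      (fun h => absurd (Finset.mem_univ p) h),
    hvec, if_pos rfl, one_smul, TensorProduct.tmul_smul, map_smul, gen]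
  congr! 5 with q
  ext x
  change Finsupp.single (f (p.succAbove q)) (1 : R) _ = Finsupp.single _ (1 : R) x
  rw [Finsupp.single_apply, Finsupp.single_apply]
  exact if_congr (⟨fun e => Subtype.ext (congrArg (fun z => z.1) e),
    fun e => Subtype.ext (congrArg (fun z => z.1) e)⟩) rfl rfl

theorem koszulD_comp_koszulD (V : FIModule R) (X : FI) (a : ℕ) :
    koszulD V X a ∘ₗ koszulD V X (a + 1) = 0 := by
  refine koszulTerm_hom_ext fun I f hf v => ?_
  rw [LinearMap.comp_apply, koszulD_gen V I f hf, map_sum, LinearMap.zero_apply]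
  have hne : ∀ (p : Fin (a + 2)) (q : Fin (a + 1)),
      (f (p.succAbove q)).1 ∈ I.set \ {(f p).1} := fun p q =>
    ⟨(f _).2, fun e => p.succAbove_ne q (hf (Subtype.ext e))⟩
  have hinj : ∀ p : Fin (a + 2), Function.Injective
      (fun q : Fin (a + 1) => (⟨(f (p.succAbove q)).1, hne p q⟩ : (I.erase (f p)).set)) :=
    fun p q q' e => Fin.succAbove_right_injective (p := p)
      (hf (Subtype.ext (congrArg (fun z => z.1) e)))
  have hne' : ∀ (p : Fin (a + 2)) (q : Fin (a + 1)) (r : Fin a),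
      (f (p.succAbove (q.succAbove r))).1 ∈
        (I.set \ {(f p).1}) \ {(f (p.succAbove q)).1} := fun p q r =>
    ⟨hne p _, fun e => q.succAbove_ne r (hinj p (Subtype.ext e))⟩
  let K : (p : Fin (a + 2)) → Fin (a + 1) → Index X a := fun p q =>
    (I.erase (f p)).erase ⟨(f (p.succAbove q)).1, hne p q⟩
  let F : Fin (a + 2) × Fin (a + 1) → KoszulTerm V X a := fun x =>
    gen V (K x.1 x.2) (fun r => ⟨(f (x.1.succAbove (x.2.succAbove r))).1, hne' x.1 x.2 r⟩)
      (V.map (FI.complIncl (Set.sdiff_subset.trans Set.sdiff_subset)) v)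
  have step : ∀ p : Fin (a + 2), koszulD V X a ((-1 : R) ^ (p.val + 1) •
        gen V (I.erase (f p)) (fun q => ⟨(f (p.succAbove q)).1, hne p q⟩)
          (V.map (insertIncl I (f p)) v)) =
      ∑ q : Fin (a + 1), (-1 : R) ^ (p.val + q.val) • F (p, q) := by
    intro p
    rw [map_smul, koszulD_gen V _ _ (hinj p), Finset.smul_sum]
    refine Finset.sum_congr rfl fun q _ => ?_
    rw [smul_smul, ← pow_add, map_map_apply,
      show p.val + 1 + (q.val + 1) = p.val + q.val + 2 by ring, pow_add, neg_one_sq, mul_one]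
    rfl
  refine (Finset.sum_congr rfl fun p _ => step p).trans ?_
  rw [← Fintype.sum_prod_type' (f := fun p q => (-1 : R) ^ (Fin.val p + Fin.val q) • F (p, q))]
  refine Finset.sum_involution (fun x _ => (x.1.succAbove x.2, x.2.predAbove x.1)) ?_ ?_
    (fun _ _ => Finset.mem_univ _) ?_
  · rintro ⟨p, q⟩ _
    have hF : F (p.succAbove q, q.predAbove p) = F (p, q) := by
      refine gen_congr V ?_ ?_ ?_ v
      · change (I.set \ {_}) \ {(f ((p.succAbove q).succAbove (q.predAbove p))).1} = _
        rw [Fin.succAbove_succAbove_predAbove]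
        exact sdiff_right_comm ..
      · exact fun r => congrArg (fun z => (f z).1)
          (Fin.succAbove_succAbove_succAbove_predAbove p q r)
      · exact fun _ => rfl
    simp only [hF]
    rw [Fin.neg_one_pow_succAbove_add_predAbove, ← add_smul, add_neg_cancel, zero_smul]
  · rintro ⟨p, q⟩ _ _ e
    exact p.succAbove_ne q (congrArg Prod.fst e)
  · rintro ⟨p, q⟩ _
    refine Prod.ext (Fin.succAbove_succAbove_predAbove p q) ?_
    refine Fin.succAbove_right_injective (p := p) ?_
    have h := Fin.succAbove_succAbove_predAbove (p.succAbove q) (q.predAbove p)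
    rwa [Fin.succAbove_succAbove_predAbove p q] at h

/-- The `FI`-module structure of the terms of the Koszul complex: an injection `α : X → Y` maps
the summand indexed by `I` to the summand indexed by `α(I)`. -/
def koszulMap (V : FIModule R) {X Y : FI} (α : X ⟶ Y) (a : ℕ) :
    KoszulTerm V X a →ₗ[R] KoszulTerm V Y a :=
  DirectSum.toModule R _ _ fun I =>
    DirectSum.lof R (Index Y a) (fun K => Summand V K) (I.image α) ∘ₗ
      TensorProduct.map (V.map (FI.complMap α I.set)).hom
        (exteriorPower.map a (Finsupp.lmapDomain R R
          (fun i : I.set => (⟨α.toFun i.1, Set.mem_image_of_mem _ i.2⟩ : (I.image α).set))))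

theorem koszulMap_gen (V : FIModule R) {X Y : FI} (α : X ⟶ Y) {a : ℕ} (I : Index X a)
    (f : Fin a → I.set) (v : V.obj (FI.compl I.set)) :
    koszulMap V α a (gen V I f v) =
      gen V (I.image α) (fun p => ⟨α.toFun (f p).1, Set.mem_image_of_mem _ (f p).2⟩)
        (V.map (FI.complMap α I.set) v) := by
  rw [gen, koszulMap, DirectSum.toModule_lof, LinearMap.comp_apply, TensorProduct.map_tmul,
    exteriorPower.map_apply_ιMulti, gen]
  congr! 3
  ext p : 1
  simp [vec]

/-- The effect of a morphism of `FI`-modules on the terms of the Koszul complex. -/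
def koszulApp {V W : FIModule R} (η : V ⟶ W) (X : FI) (a : ℕ) :
    KoszulTerm V X a →ₗ[R] KoszulTerm W X a :=
  DirectSum.toModule R _ _ fun I =>
    DirectSum.lof R (Index X a) (fun K => Summand W K) I ∘ₗ
      TensorProduct.map (η.app (FI.compl I.set)).hom LinearMap.id

theorem koszulApp_gen {V W : FIModule R} (η : V ⟶ W) {X : FI} {a : ℕ} (I : Index X a)
    (f : Fin a → I.set) (v : V.obj (FI.compl I.set)) :
    koszulApp η X a (gen V I f v) = gen W I f (η.app _ v) := by
  rw [gen, koszulApp, DirectSum.toModule_lof, LinearMap.comp_apply, TensorProduct.map_tmul, gen]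
  rfl

theorem koszulMap_id (V : FIModule R) (X : FI) (a : ℕ) :
    koszulMap V (𝟙 X) a = LinearMap.id := by
  refine koszulTerm_hom_ext fun I f hf v => ?_
  rw [koszulMap_gen, LinearMap.id_apply]
  have h := gen_congr V (I := I.image (𝟙 X)) (I' := I) (Set.image_id I.set)
    (f := fun p => ⟨(f p).1, Set.mem_image_of_mem _ (f p).2⟩) (f' := f) (fun _ => rfl)
    (g := FI.complMap (𝟙 X) I.set) (g' := 𝟙 _) (fun _ => rfl) v
  refine h.trans ?_
  rw [V.map_id]
  rfl

theorem koszulMap_comp (V : FIModule R) {X Y Z : FI} (α : X ⟶ Y) (β : Y ⟶ Z) (a : ℕ) :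
    koszulMap V (α ≫ β) a = koszulMap V β a ∘ₗ koszulMap V α a := by
  refine koszulTerm_hom_ext fun I f hf v => ?_
  rw [LinearMap.comp_apply, koszulMap_gen, koszulMap_gen, koszulMap_gen, map_map_apply]
  refine gen_congr V ?_ ?_ ?_ v
  · exact Set.image_comp β.toFun α.toFun I.set
  · exact fun _ => rfl
  · exact fun _ => rfl

theorem koszulApp_comp_koszulMap {V W : FIModule R} (η : V ⟶ W) {X Y : FI} (α : X ⟶ Y) (a : ℕ) :
    koszulApp η Y a ∘ₗ koszulMap V α a = koszulMap W α a ∘ₗ koszulApp η X a := by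
  refine koszulTerm_hom_ext fun I f hf v => ?_
  rw [LinearMap.comp_apply, LinearMap.comp_apply, koszulMap_gen, koszulApp_gen, koszulApp_gen,
    koszulMap_gen, app_map_apply]

theorem koszulD_comp_koszulMap (V : FIModule R) {X Y : FI} (α : X ⟶ Y) (a : ℕ) :
    koszulD V Y a ∘ₗ koszulMap V α (a + 1) = koszulMap V α a ∘ₗ koszulD V X a := by
  refine koszulTerm_hom_ext fun I f hf v => ?_
  rw [LinearMap.comp_apply, LinearMap.comp_apply, koszulMap_gen, koszulD_gen V I f hf,
    koszulD_gen V _ _ (fun p q e => hf (Subtype.ext (α.injective (congrArg Subtype.val e)))),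
    map_sum]
  refine Finset.sum_congr rfl fun p _ => ?_
  rw [map_smul, koszulMap_gen, map_map_apply, map_map_apply]
  congr 1
  refine gen_congr V ?_ ?_ ?_ v
  rotate_left
  · exact fun _ => rfl
  · exact fun _ => rfl
  change α.toFun '' I.set \ {α.toFun (f p).1} = α.toFun '' (I.set \ {(f p).1})
  rw [Set.image_sdiff α.injective, Set.image_singleton]

theorem koszulD_comp_koszulApp {V W : FIModule R} (η : V ⟶ W) (X : FI) (a : ℕ) :
    koszulD W X a ∘ₗ koszulApp η X (a + 1) = koszulApp η X a ∘ₗ koszulD V X a := by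
  refine koszulTerm_hom_ext fun I f hf v => ?_
  rw [LinearMap.comp_apply, LinearMap.comp_apply, koszulApp_gen, koszulD_gen V I f hf,
    koszulD_gen W I f hf, map_sum]
  refine Finset.sum_congr rfl fun p _ => ?_
  rw [map_smul, koszulApp_gen, app_map_apply]

/-- The `FI`-module in homological degree `a` of the Koszul complex of `V`. -/
def koszulModule (V : FIModule R) (a : ℕ) : FIModule R where
  obj X := ModuleCat.of R (KoszulTerm V X a)
  map α := ModuleCat.ofHom (koszulMap V α a)
  map_id X := by rw [koszulMap_id]; rfl
  map_comp α β := by rw [koszulMap_comp]; rfl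

/-- The differential of the Koszul complex as a morphism of `FI`-modules. -/
def koszulDifferential (V : FIModule R) (a : ℕ) : koszulModule V (a + 1) ⟶ koszulModule V a where
  app X := ModuleCat.ofHom (koszulD V X a)
  naturality _ _ α := ModuleCat.hom_ext (koszulD_comp_koszulMap V α a)

/-- The Koszul (central stability) complex of an `FI`-module. -/
def koszulComplex (V : FIModule R) : ChainComplex (FIModule R) ℕ :=
  ChainComplex.of (koszulModule V) (koszulDifferential V) fun a => by
    ext X : 3
    exact koszulD_comp_koszulD V X a

theorem koszulComplex_d (V : FIModule R) (a : ℕ) :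
    (koszulComplex V).d (a + 1) a = koszulDifferential V a :=
  ChainComplex.of_d _ _ _

/-- The morphism of Koszul complexes induced by a morphism of `FI`-modules. -/
def koszulComplexMap {V W : FIModule R} (η : V ⟶ W) : koszulComplex V ⟶ koszulComplex W :=
  ChainComplex.ofHom
    (fun a : ℕ =>
      ({ app := fun X => ModuleCat.ofHom (koszulApp η X a)
         naturality := fun _ _ α => ModuleCat.hom_ext (koszulApp_comp_koszulMap η α a) } :
        koszulModule V a ⟶ koszulModule W a))
    fun a => by
      rw [koszulComplex_d, koszulComplex_d]
      ext X : 3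
      exact koszulD_comp_koszulApp η X a

/-- The Koszul complex as a functor. -/
def koszulFunctor (R : Type u) [CommRing R] : FIModule R ⥤ ChainComplex (FIModule R) ℕ where
  obj V := koszulComplex V
  map η := koszulComplexMap η
  map_id V := by
    ext a X : 4
    refine koszulTerm_hom_ext fun I f _ v => ?_
    exact koszulApp_gen (𝟙 V) I f v
  map_comp η θ := by
    ext a X : 4
    refine koszulTerm_hom_ext fun I f _ v => ?_
    refine (koszulApp_gen (η ≫ θ) I f v).trans ?_
    exact ((congrArg (koszulApp θ X a) (koszulApp_gen η I f v)).trans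
      (koszulApp_gen θ I f _)).symm

/-- The `a`-th homology of the Koszul complex, as a functor. -/
def koszulHomology (R : Type u) [CommRing R] (a : ℕ) : FIModule R ⥤ FIModule R :=
  koszulFunctor R ⋙ HomologicalComplex.homologyFunctor (FIModule R) (ComplexShape.down ℕ) a

end FIModule

end

noncomputable section

open CategoryTheory.Limits

/-! ### Functorial projective resolutions by iterated syzygies. -/

namespace CategoryTheory

universe v₁ v₂ u₁ u₂

/-! The Koszul complex is an exact functor of `V`, its homology in degree zero is `V / JV`, and it
is acyclic in positive degrees on free modules. Any such functor to complexes computes the left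
derived functors of its zeroth homology `F`; this is `nonempty_leftDerived_iso`.

The comparison rests on a functorial cover `0 → Ω V → P V → V → 0` with `P V` projective, so that
naturality needs no choice of resolutions. Splicing covers gives a resolution, which exhibits the
derived functor in degree `n + 1` as the kernel of `F(Ωⁿ⁺¹ V) → F(P Ωⁿ V)`
(`leftDerivedToSyzygy_exact`). Dimension shifting along the long exact sequences exhibits the
homology of the complex in degree `n + 1` as the kernel of the same map
(`nonempty_homology_iso_syzygy`, `connecting_exact`). Both inclusions are natural, hence so is the
resulting isomorphism.

For `FI`-modules, exactness holds because `det I` is free, hence flat (`koszulFunctor_shortExact`).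
The zeroth homology is `V / JV` because a non-surjective injection into `X` factors through the
complement of a point (`range_koszulZeroTo_koszulD`). On a free module, the complex at `X` splits
according to the label and the injection `g` into `X` that make up a basis element; wedging with a
point outside the image of `g` contracts each summand in positive degrees (`koszulD_homotopy`). The
point is chosen separately for each `X`, which suffices because exactness is tested pointwise. -/

theorem ShortComplex.Exact.epi_comp_mono {D : Type u₂} [Category.{v₂} D] [Abelian D]
    {X₁ X₂ X₃ Y Z : D} {f : X₁ ⟶ X₂} {g : X₂ ⟶ X₃} {w : f ≫ g = 0}
    (hS : (ShortComplex.mk f g w).Exact) (p : Y ⟶ X₁) [Epi p] (i : X₃ ⟶ Z) [Mono i] :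
    (ShortComplex.mk (p ≫ f) (g ≫ i) (by simp [reassoc_of% w])).Exact := by
  let φ : ShortComplex.mk (p ≫ f) g (by simp [w]) ⟶ ShortComplex.mk f g w :=
    { τ₁ := p, τ₂ := 𝟙 _, τ₃ := 𝟙 _ }
  let ψ : ShortComplex.mk (p ≫ f) g (by simp [w]) ⟶
      ShortComplex.mk (p ≫ f) (g ≫ i) (by simp [reassoc_of% w]) :=
    { τ₁ := 𝟙 _, τ₂ := 𝟙 _, τ₃ := i }
  have : Epi φ.τ₁ := ‹Epi p›
  have : IsIso φ.τ₂ := inferInstanceAs (IsIso (𝟙 _))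
  have : Mono φ.τ₃ := inferInstanceAs (Mono (𝟙 _))
  have : Epi ψ.τ₁ := inferInstanceAs (Epi (𝟙 _))
  have : IsIso ψ.τ₂ := inferInstanceAs (IsIso (𝟙 _))
  have : Mono ψ.τ₃ := ‹Mono i›
  rw [← ShortComplex.exact_iff_of_epi_of_isIso_of_mono ψ]
  exact (ShortComplex.exact_iff_of_epi_of_isIso_of_mono φ).2 hS

/-- A functorial projective cover `P V ⟶ V` of the objects of an abelian category, with a
functorial kernel `Ω V`. -/
structure FunctorialCover (C : Type u₁) [Category.{v₁} C] [Abelian C] where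
  P : C ⥤ C
  Ω : C ⥤ C
  ι (V : C) : Ω.obj V ⟶ P.obj V
  π (V : C) : P.obj V ⟶ V
  ι_naturality {V W : C} (f : V ⟶ W) : Ω.map f ≫ ι W = ι V ≫ P.map f
  π_naturality {V W : C} (f : V ⟶ W) : P.map f ≫ π W = π V ≫ f
  w (V : C) : ι V ≫ π V = 0
  shortExact (V : C) : (ShortComplex.mk (ι V) (π V) (w V)).ShortExact
  projective (V : C) : Projective (P.obj V)

namespace FunctorialCover

variable {C : Type u₁} [Category.{v₁} C] [Abelian C]

/-- A functorial epimorphism from projective objects defines a functorial cover. -/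
def ofEpi (P : C ⥤ C) (π : P ⟶ 𝟭 C) (hP : ∀ V, Projective (P.obj V))
    (hπ : ∀ V, Epi (π.app V)) : FunctorialCover C where
  P := P
  Ω :=
    { obj V := kernel (π.app V)
      map {V W} f := kernel.map (π.app V) (π.app W) (P.map f) f (π.naturality f).symm
      map_id V := by ext; simp
      map_comp f g := by ext; simp }
  ι V := kernel.ι (π.app V)
  π V := π.app V
  ι_naturality f := by simp
  π_naturality f := π.naturality f
  w V := kernel.condition _
  shortExact V :=
    { exact := ShortComplex.exact_kernel _
      mono_f := by dsimp; infer_instance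
      epi_g := hπ V }
  projective := hP

variable (c : FunctorialCover C)

instance (V : C) : Epi (c.π V) := (c.shortExact V).epi_g

instance (V : C) : Mono (c.ι V) := (c.shortExact V).mono_f

/-- The short exact sequence `0 ⟶ Ω V ⟶ P V ⟶ V ⟶ 0`, as a functor of `V`. -/
@[simps]
def shortComplex : C ⥤ ShortComplex C where
  obj V := ShortComplex.mk (c.ι V) (c.π V) (c.w V)
  map f :=
    { τ₁ := c.Ω.map f
      τ₂ := c.P.map f
      τ₃ := f
      comm₁₂ := c.ι_naturality f
      comm₂₃ := c.π_naturality f }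

/-- The iterated syzygy functors. -/
def syzygy : ℕ → C ⥤ C
  | 0 => 𝟭 C
  | n + 1 => syzygy n ⋙ c.Ω

/-- The inclusion of a syzygy into the cover of the previous one. -/
def syzygyι (n : ℕ) (V : C) : (c.syzygy (n + 1)).obj V ⟶ c.P.obj ((c.syzygy n).obj V) :=
  c.ι _

theorem syzygyι_naturality (n : ℕ) {V W : C} (f : V ⟶ W) :
    (c.syzygy (n + 1)).map f ≫ c.syzygyι n W =
      c.syzygyι n V ≫ c.P.map ((c.syzygy n).map f) :=
  c.ι_naturality _

theorem syzygyι_π (n : ℕ) (V : C) : c.syzygyι n V ≫ c.π ((c.syzygy n).obj V) = 0 :=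
  c.w _

theorem syzygy_shortExact (n : ℕ) (V : C) :
    (ShortComplex.mk (c.syzygyι n V) (c.π ((c.syzygy n).obj V)) (c.syzygyι_π n V)).ShortExact :=
  c.shortExact _

instance (n : ℕ) (V : C) : Mono (c.syzygyι n V) := (c.syzygy_shortExact n V).mono_f

/-- The functorial resolution, whose term in degree `n` is the cover of the `n`-th syzygy. -/
def resolutionComplex (V : C) : ChainComplex C ℕ :=
  ChainComplex.of (fun n => c.P.obj ((c.syzygy n).obj V))
    (fun n => c.π ((c.syzygy (n + 1)).obj V) ≫ c.syzygyι n V)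
    fun n => by simp [reassoc_of% c.syzygyι_π]

theorem resolutionComplex_d (V : C) (n : ℕ) :
    (c.resolutionComplex V).d (n + 1) n = c.π ((c.syzygy (n + 1)).obj V) ≫ c.syzygyι n V :=
  ChainComplex.of_d (fun n => c.P.obj ((c.syzygy n).obj V))
    (fun n => c.π ((c.syzygy (n + 1)).obj V) ≫ c.syzygyι n V) n

/-- The morphism of functorial resolutions induced by a morphism. -/
def resolutionMap {V W : C} (f : V ⟶ W) : c.resolutionComplex V ⟶ c.resolutionComplex W :=
  ChainComplex.ofHom (fun n => c.P.map ((c.syzygy n).map f)) fun n => by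
    rw [resolutionComplex_d, resolutionComplex_d]
    have h : c.P.map ((c.syzygy (n + 1)).map f) ≫ c.π ((c.syzygy (n + 1)).obj W) ≫ c.syzygyι n W =
        (c.π ((c.syzygy (n + 1)).obj V) ≫ c.syzygyι n V) ≫ c.P.map ((c.syzygy n).map f) := by
      rw [Category.assoc, ← syzygyι_naturality, reassoc_of% c.π_naturality]
    exact h

/-- Each differential is a cover followed by the inclusion of a syzygy. Precomposing with an
epimorphism and postcomposing with a monomorphism changes neither the image nor the kernel in the
middle of the short exact sequence of a syzygy. -/
theorem resolutionComplex_exactAt_succ (V : C) (n : ℕ) :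
    (c.resolutionComplex V).ExactAt (n + 1) := by
  rw [HomologicalComplex.exactAt_iff' _ (n + 1 + 1) (n + 1) n (by simp) (by simp)]
  refine ShortComplex.exact_of_iso ?_ ((c.syzygy_shortExact (n + 1) V).exact.epi_comp_mono
    (c.π ((c.syzygy (n + 2)).obj V)) (c.syzygyι n V))
  refine ShortComplex.isoMk (Iso.refl _) (Iso.refl _) (Iso.refl _) ?_ ?_
  · exact (Category.id_comp _).trans ((c.resolutionComplex_d V (n + 1)).trans
      (Category.comp_id _).symm)
  · exact (Category.id_comp _).trans ((c.resolutionComplex_d V n).trans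
      (Category.comp_id _).symm)

/-- The functorial projective resolution. -/
def resolution (V : C) : ProjectiveResolution V where
  complex := c.resolutionComplex V
  projective n := c.projective _
  π := (ChainComplex.toSingle₀Equiv _ _).symm ⟨c.π V, by
    rw [resolutionComplex_d]
    have h : (c.π ((c.syzygy 1).obj V) ≫ c.syzygyι 0 V) ≫ c.π ((c.syzygy 0).obj V) = 0 := by
      rw [Category.assoc, syzygyι_π, comp_zero]
    exact h⟩
  quasiIso := ⟨fun n => by
    cases n
    -- In degree zero the claim becomes exactness of `X₁ → X₀ → V` together with surjectivity of the
    -- last map; the identity plays the role of the monomorphism in the splicing lemma.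
    · rw [ChainComplex.quasiIsoAt₀_iff, ShortComplex.quasiIso_iff_of_zeros']
      · have h := (c.syzygy_shortExact 0 V).exact.epi_comp_mono (c.π ((c.syzygy 1).obj V))
          (𝟙 _)
        refine (ShortComplex.exact_and_epi_g_iff_of_iso ?_).2
          ⟨h, epi_comp (c.π ((c.syzygy 0).obj V)) (𝟙 _)⟩
        refine ShortComplex.isoMk (Iso.refl _) (Iso.refl _) (Iso.refl _) ?_ ?_
        · exact (Category.id_comp _).trans ((c.resolutionComplex_d V 0).symm.trans
            (Category.comp_id _).symm)
        · refine (Category.id_comp _).trans ((Category.comp_id _).trans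
            (Eq.trans ?_ (Category.comp_id _).symm))
          exact (ChainComplex.toSingle₀Equiv_symm_apply_f_zero (C := c.resolutionComplex V) _ _).symm
      all_goals rfl
    · rw [quasiIsoAt_iff_exactAt']
      · apply resolutionComplex_exactAt_succ
      · apply ChainComplex.exactAt_succ_single_obj⟩

/-- The map from the functorial resolution in degree `n` onto the `n`-th syzygy. -/
def toSyzygy (n : ℕ) (V : C) : (c.resolutionComplex V).X n ⟶ (c.syzygy n).obj V :=
  c.π _

/-- The inclusion of the `(n + 1)`-st syzygy in the functorial resolution in degree `n`. -/
def fromSyzygy (n : ℕ) (V : C) : (c.syzygy (n + 1)).obj V ⟶ (c.resolutionComplex V).X n :=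
  c.syzygyι n V

theorem resolutionComplex_d_eq (V : C) (n : ℕ) :
    (c.resolutionComplex V).d (n + 1) n = c.toSyzygy (n + 1) V ≫ c.fromSyzygy n V :=
  c.resolutionComplex_d V n

theorem fromSyzygy_toSyzygy (n : ℕ) (V : C) : c.fromSyzygy n V ≫ c.toSyzygy n V = 0 :=
  c.w _

theorem resolutionMap_f_toSyzygy (n : ℕ) {V W : C} (f : V ⟶ W) :
    (c.resolutionMap f).f n ≫ c.toSyzygy n W = c.toSyzygy n V ≫ (c.syzygy n).map f :=
  c.π_naturality _

instance (n : ℕ) (V : C) : Epi (c.toSyzygy n V) :=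
  inferInstanceAs (Epi (c.π _))

theorem d_toSyzygy (n : ℕ) (V : C) :
    (c.resolutionComplex V).d (n + 1) n ≫ c.toSyzygy n V = 0 := by
  rw [resolutionComplex_d_eq, Category.assoc, fromSyzygy_toSyzygy, comp_zero]

/-- This presents the syzygy as a cokernel of the differential, a description that a right exact
functor preserves. -/
theorem d_toSyzygy_exact (n : ℕ) (V : C) :
    (ShortComplex.mk _ _ (c.d_toSyzygy n V)).Exact := by
  refine ShortComplex.exact_of_iso ?_ ((c.syzygy_shortExact n V).exact.epi_comp_mono
    (c.π ((c.syzygy (n + 1)).obj V)) (𝟙 _))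
  refine ShortComplex.isoMk (Iso.refl _) (Iso.refl _) (Iso.refl _) ?_ ?_
  · exact (Category.id_comp _).trans ((c.resolutionComplex_d V n).trans
      (Category.comp_id _).symm)
  · exact (Category.id_comp _).trans
      ((Category.comp_id _).symm.trans (Category.comp_id _).symm)

end FunctorialCover

/-- Opcycles and `A` are both cokernels of the incoming differential. This serves for the image of
the resolution under `F` and for the Koszul complex in degree zero. -/
theorem isIso_descOpcycles_of_exact {D : Type u₂} [Category.{v₂} D] [Abelian D] {ι : Type*}
    {s : ComplexShape ι} (K : HomologicalComplex D s) {i j : ι} (hj : s.prev i = j) {A : D}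
    (k : K.X i ⟶ A) [Epi k] (hk : K.d j i ≫ k = 0) (h : (ShortComplex.mk _ _ hk).Exact) :
    IsIso (K.descOpcycles k j hj hk) := by
  have : Epi (ShortComplex.mk (K.d j i) k hk).g := ‹Epi k›
  let g : A ⟶ K.opcycles i := h.desc (K.pOpcycles i) (K.d_pOpcycles j i)
  have hg : k ≫ g = K.pOpcycles i := h.g_desc _ _
  refine ⟨g, ?_, ?_⟩
  · rw [← cancel_epi (K.pOpcycles i), HomologicalComplex.p_descOpcycles_assoc, hg,
      Category.comp_id]
  · rw [← cancel_epi k, reassoc_of% hg, HomologicalComplex.p_descOpcycles, Category.comp_id]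

/-- Two functors which are both kernels of the same family of morphisms are isomorphic, if their
inclusions are natural. -/
theorem nonempty_iso_of_exact {C : Type u₁} [Category.{v₁} C] {D : Type u₂} [Category.{v₂} D]
    [Abelian D] {G G' A : C ⥤ D} {B : C → D} (f : ∀ V, A.obj V ⟶ B V) (m : G ⟶ A) (m' : G' ⟶ A)
    [∀ V, Mono (m.app V)] [∀ V, Mono (m'.app V)] (w : ∀ V, m.app V ≫ f V = 0)
    (w' : ∀ V, m'.app V ≫ f V = 0) (h : ∀ V, (ShortComplex.mk _ _ (w V)).Exact)
    (h' : ∀ V, (ShortComplex.mk _ _ (w' V)).Exact) : Nonempty (G ≅ G') := by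
  have : ∀ V, Mono (ShortComplex.mk _ _ (w V)).f := fun V => ‹∀ V, Mono (m.app V)› V
  have : ∀ V, Mono (ShortComplex.mk _ _ (w' V)).f := fun V => ‹∀ V, Mono (m'.app V)› V
  let e : ∀ V, G.obj V ⟶ G'.obj V := fun V => (h' V).lift (m.app V) (w V)
  let e' : ∀ V, G'.obj V ⟶ G.obj V := fun V => (h V).lift (m'.app V) (w' V)
  have he : ∀ V, e V ≫ m'.app V = m.app V := fun V => (h' V).lift_f _ _
  have he' : ∀ V, e' V ≫ m.app V = m'.app V := fun V => (h V).lift_f _ _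
  refine ⟨NatIso.ofComponents (fun V => ⟨e V, e' V, ?_, ?_⟩) fun {V W} f => ?_⟩
  · rw [← cancel_mono (m.app V), Category.assoc, he', he, Category.id_comp]
  · rw [← cancel_mono (m'.app V), Category.assoc, he, he', Category.id_comp]
  · rw [← cancel_mono (m'.app W), Category.assoc, he, Category.assoc, m'.naturality,
      reassoc_of% he, m.naturality]

/-! ### Left derived functors as kernels of maps out of syzygies. -/

namespace FunctorialCover

variable {C : Type u₁} [Category.{v₁} C] [Abelian C]
  {D : Type u₂} [Category.{v₂} D] [Abelian D] (c : FunctorialCover C) (F : C ⥤ D) [F.Additive]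

/-- The image of the functorial resolution under an additive functor. -/
abbrev mapResolution (V : C) : ChainComplex D ℕ :=
  (F.mapHomologicalComplex _).obj (c.resolutionComplex V)

/-- The image of the map from the functorial resolution onto a syzygy. -/
def mapToSyzygy (n : ℕ) (V : C) :
    (c.mapResolution F V).X n ⟶ (c.syzygy n ⋙ F).obj V :=
  F.map (c.toSyzygy n V)

theorem d_mapToSyzygy (n : ℕ) (V : C) :
    (c.mapResolution F V).d (n + 1) n ≫ c.mapToSyzygy F n V = 0 :=
  (F.map_comp _ _).symm.trans ((congrArg F.map (c.d_toSyzygy n V)).trans (F.map_zero _ _))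

theorem mapResolution_d (n : ℕ) (V : C) :
    c.mapToSyzygy F (n + 1) V ≫ F.map (c.fromSyzygy n V) =
      (c.mapResolution F V).d (n + 1) n :=
  (F.map_comp _ _).symm.trans (congrArg F.map (c.resolutionComplex_d_eq V n).symm)

theorem mapToSyzygy_naturality (n : ℕ) {V W : C} (f : V ⟶ W) :
    ((F.mapHomologicalComplex _).map (c.resolutionMap f)).f n ≫ c.mapToSyzygy F n W =
      c.mapToSyzygy F n V ≫ (c.syzygy n ⋙ F).map f :=
  (F.map_comp _ _).symm.trans
    ((congrArg F.map (c.resolutionMap_f_toSyzygy n f)).trans (F.map_comp _ _))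

/-- The map from the image of a cover to the image of the syzygy, on opcycles. -/
def opcyclesToSyzygy (n : ℕ) (V : C) :
    (c.mapResolution F V).opcycles n ⟶ (c.syzygy n ⋙ F).obj V :=
  (c.mapResolution F V).descOpcycles (c.mapToSyzygy F n V) (n + 1) (by simp)
    (c.d_mapToSyzygy F n V)

theorem pOpcycles_opcyclesToSyzygy (n : ℕ) (V : C) :
    (c.mapResolution F V).pOpcycles n ≫ c.opcyclesToSyzygy F n V = c.mapToSyzygy F n V :=
  HomologicalComplex.p_descOpcycles _ _ _ _ _

/-- The image of the inclusion of a syzygy. -/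
def mapFromSyzygy (n : ℕ) (V : C) :
    (c.syzygy (n + 1) ⋙ F).obj V ⟶ (c.mapResolution F V).X n :=
  F.map (c.fromSyzygy n V)

theorem opcyclesToSyzygy_map (n : ℕ) (V : C) :
    c.opcyclesToSyzygy F (n + 1) V ≫ c.mapFromSyzygy F n V =
      (c.mapResolution F V).fromOpcycles (n + 1) n := by
  rw [← cancel_epi ((c.mapResolution F V).pOpcycles (n + 1)),
    reassoc_of% c.pOpcycles_opcyclesToSyzygy F, HomologicalComplex.p_fromOpcycles]
  exact c.mapResolution_d F n V

theorem opcyclesToSyzygy_naturality (n : ℕ) {V W : C} (f : V ⟶ W) :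
    HomologicalComplex.opcyclesMap ((F.mapHomologicalComplex _).map (c.resolutionMap f)) n ≫
      c.opcyclesToSyzygy F n W = c.opcyclesToSyzygy F n V ≫ (c.syzygy n ⋙ F).map f := by
  rw [← cancel_epi ((c.mapResolution F V).pOpcycles n),
    HomologicalComplex.p_opcyclesMap_assoc, pOpcycles_opcyclesToSyzygy,
    reassoc_of% c.pOpcycles_opcyclesToSyzygy F, mapToSyzygy_naturality]

instance [PreservesFiniteColimits F] (n : ℕ) (V : C) : IsIso (c.opcyclesToSyzygy F n V) := by
  have h := (F.preservesFiniteColimits_tfae.out 3 1 :).1 inferInstance _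
    ⟨c.d_toSyzygy_exact n V, (inferInstance : Epi (c.toSyzygy n V))⟩
  have : Epi (c.mapToSyzygy F n V) := h.2
  exact isIso_descOpcycles_of_exact _ _ _ _ h.1

variable [HasProjectiveResolutions C]

/-- The left derived functor, computed by the functorial resolution. -/
def leftDerivedIso (n : ℕ) (V : C) :
    (F.leftDerived n).obj V ≅ (c.mapResolution F V).homology n :=
  (c.resolution V).isoLeftDerivedObj F n

theorem leftDerivedIso_naturality (n : ℕ) {V W : C} (f : V ⟶ W) :
    (F.leftDerived n).map f ≫ (c.leftDerivedIso F n W).hom =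
      (c.leftDerivedIso F n V).hom ≫ HomologicalComplex.homologyMap
        ((F.mapHomologicalComplex _).map (c.resolutionMap f)) n :=
  ProjectiveResolution.isoLeftDerivedObj_hom_naturality f (c.resolution V)
    (c.resolution W) (c.resolutionMap f) (by
      have hπ : ∀ U, (c.resolution U).π.f 0 = c.toSyzygy 0 U := fun U =>
        ChainComplex.toSingle₀Equiv_symm_apply_f_zero (C := c.resolutionComplex U) _ _
      rw [hπ, hπ]
      exact c.resolutionMap_f_toSyzygy 0 f) F n

/-- The canonical map from a left derived functor to the value of the functor on a syzygy. -/
def leftDerivedToSyzygy (n : ℕ) : F.leftDerived n ⟶ c.syzygy n ⋙ F where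
  app V := (c.leftDerivedIso F n V).hom ≫
    (c.mapResolution F V).homologyι n ≫ c.opcyclesToSyzygy F n V
  naturality V W f := by
    rw [reassoc_of% c.leftDerivedIso_naturality F, HomologicalComplex.homologyι_naturality_assoc,
      opcyclesToSyzygy_naturality]
    simp only [Category.assoc]

instance [PreservesFiniteColimits F] (n : ℕ) (V : C) :
    Mono ((c.leftDerivedToSyzygy F n).app V) := by
  dsimp [leftDerivedToSyzygy]
  infer_instance

theorem leftDerivedToSyzygy_map (n : ℕ) (V : C) :
    (c.leftDerivedToSyzygy F (n + 1)).app V ≫ c.mapFromSyzygy F n V = 0 := by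
  simp only [leftDerivedToSyzygy, Category.assoc, opcyclesToSyzygy_map,
    HomologicalComplex.homologyι_comp_fromOpcycles, comp_zero]

/-- Homology is the kernel of the map from opcycles to the next term. Right exactness of `F`
identifies the opcycles with `F` of the syzygy, and the map with `F` of the syzygy inclusion. -/
theorem leftDerivedToSyzygy_exact [PreservesFiniteColimits F] (n : ℕ) (V : C) :
    (ShortComplex.mk _ _ (c.leftDerivedToSyzygy_map F n V)).Exact := by
  have h := ShortComplex.exact_of_f_is_kernel
    (ShortComplex.mk _ _ ((c.mapResolution F V).homologyι_comp_fromOpcycles (n + 1) n))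
    ((c.mapResolution F V).homologyIsKernel (n + 1) n (by simp))
  refine ShortComplex.exact_of_iso ?_ h
  refine ShortComplex.isoMk (c.leftDerivedIso F (n + 1) V).symm
    (asIso (c.opcyclesToSyzygy F (n + 1) V)) (Iso.refl _) ?_ ?_
  · simp [leftDerivedToSyzygy]
  · dsimp
    rw [opcyclesToSyzygy_map, Category.comp_id]

end FunctorialCover

/-! ### Comparison with the homology of an exact functor to chain complexes. -/

namespace FunctorialCover

open HomologicalComplex

variable {C : Type u₁} [Category.{v₁} C] [Abelian C]
  {D : Type u₂} [Category.{v₂} D] [Abelian D] (c : FunctorialCover C)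
  (K : C ⥤ ChainComplex D ℕ) [K.Additive]

theorem preservesFiniteColimits_homology_zero
    (hK : ∀ S : ShortComplex C, S.ShortExact → (S.map K).ShortExact) :
    PreservesFiniteColimits (K ⋙ homologyFunctor D (ComplexShape.down ℕ) 0) := by
  refine ((Functor.preservesFiniteColimits_tfae
    (K ⋙ homologyFunctor D (ComplexShape.down ℕ) 0)).out 0 3 :).1 fun S hS => ?_
  have h := hK S hS
  refine ⟨h.homology_exact₂ 0, ?_⟩
  have : Epi (S.map K).g := h.epi_g
  -- Nothing leaves degree zero, so homology agrees there with opcycles, which preserve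
  -- epimorphisms.
  have : Epi (opcyclesMap (S.map K).g 0) := inferInstance
  have hnat := homologyι_naturality (S.map K).g 0
  have : Epi (homologyMap (S.map K).g 0) := by
    have e : homologyMap (S.map K).g 0 = homologyι (S.map K).X₂ 0 ≫
        opcyclesMap (S.map K).g 0 ≫ inv (homologyι (S.map K).X₃ 0) := by
      rw [← reassoc_of% hnat, IsIso.hom_inv_id, Category.comp_id]
    rw [e]
    infer_instance
  exact this

variable {K} (hK : ∀ S : ShortComplex C, S.ShortExact → (S.map K).ShortExact)

/-- The connecting morphism for the functorial short exact sequence of a cover. -/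
def connecting (n : ℕ) : K ⋙ homologyFunctor D (ComplexShape.down ℕ) (n + 1) ⟶
    c.Ω ⋙ K ⋙ homologyFunctor D (ComplexShape.down ℕ) n where
  app V := (hK _ (c.shortExact V)).δ (n + 1) n (by simp)
  naturality V W f :=
    (HomologySequence.δ_naturality (K.mapShortComplex.map (c.shortComplex.map f))
      (hK _ (c.shortExact V)) (hK _ (c.shortExact W)) (n + 1) n (by simp)).symm

theorem connecting_exact (n : ℕ) (V : C) :
    (ShortComplex.mk ((c.connecting hK n).app V) (homologyMap (K.map (c.ι V)) n)
      ((hK _ (c.shortExact V)).δ_comp (n + 1) n (by simp))).Exact :=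
  (hK _ (c.shortExact V)).homology_exact₁ (n + 1) n (by simp)

theorem connecting_mono
    (hP : ∀ n V, IsZero ((K.obj (c.P.obj V)).homology (n + 1)))
    (n : ℕ) (V : C) : Mono ((c.connecting hK n).app V) :=
  (hK _ (c.shortExact V)).mono_δ (n + 1) n (by simp) (hP n V)

/-- Dimension shifting: the connecting morphism from degree `k + 2` to `k + 1` is invertible because
both neighbouring homology groups of the cover vanish. The target degree stays positive, since the
zeroth homology of the cover need not vanish; `k` varies because every shift consumes one degree. -/
theorem nonempty_homology_iso_syzygy
    (hK : ∀ S : ShortComplex C, S.ShortExact → (S.map K).ShortExact)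
    (hP : ∀ n V, IsZero ((K.obj (c.P.obj V)).homology (n + 1)))
    (n k : ℕ) :
    Nonempty (K ⋙ homologyFunctor D (ComplexShape.down ℕ) (n + k + 1) ≅
      c.syzygy n ⋙ K ⋙ homologyFunctor D (ComplexShape.down ℕ) (k + 1)) := by
  induction n generalizing k with
  | zero => rw [Nat.zero_add]; exact ⟨(Functor.leftUnitor _).symm⟩
  | succ n ih =>
    have hiso : ∀ V, IsIso ((c.connecting hK (k + 1)).app V) := fun V =>
      (hK _ (c.shortExact V)).isIso_δ (k + 1 + 1) (k + 1) (by simp) (hP (k + 1) V) (hP k V)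
    have := NatIso.isIso_of_isIso_app (c.connecting hK (k + 1))
    obtain ⟨α⟩ := ih (k + 1)
    rw [show n + 1 + k + 1 = n + (k + 1) + 1 by omega]
    exact ⟨α ≪≫ Functor.isoWhiskerLeft (c.syzygy n) (asIso (c.connecting hK (k + 1)))⟩

/-- If `K` is an exact functor to chain complexes, such that the complexes of enough projective
objects are acyclic in positive degrees, then the homology of `K` is the left derived functor of
its homology in degree zero. -/
theorem nonempty_leftDerived_iso [HasProjectiveResolutions C]
    (hK : ∀ S : ShortComplex C, S.ShortExact → (S.map K).ShortExact)
    (hP : ∀ n V, IsZero ((K.obj (c.P.obj V)).homology (n + 1)))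
    (F : C ⥤ D) [F.Additive]
    (e : K ⋙ homologyFunctor D (ComplexShape.down ℕ) 0 ≅ F) (a : ℕ) :
    Nonempty (F.leftDerived a ≅ K ⋙ homologyFunctor D (ComplexShape.down ℕ) a) := by
  have := preservesFiniteColimits_homology_zero K hK
  have : PreservesFiniteColimits F := preservesFiniteColimits_of_natIso e
  obtain _ | n := a
  · exact ⟨F.leftDerivedZeroIsoSelf ≪≫ e.symm⟩
  obtain ⟨α⟩ := c.nonempty_homology_iso_syzygy hK hP n 0
  -- Shift down to degree one, then apply one more connecting morphism; this last one is only
  -- injective, with image the kernel of the map to the zeroth homology of the cover.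
  let m : K ⋙ homologyFunctor D (ComplexShape.down ℕ) (n + 1) ⟶ c.syzygy (n + 1) ⋙ F :=
    α.hom ≫ Functor.whiskerLeft (c.syzygy n)
      (c.connecting hK 0 ≫ Functor.whiskerLeft c.Ω e.hom)
  have hm : ∀ V, m.app V = α.hom.app V ≫ (c.connecting hK 0).app ((c.syzygy n).obj V) ≫
      e.hom.app (c.Ω.obj ((c.syzygy n).obj V)) := fun V => rfl
  have hmono : ∀ V, Mono (m.app V) := fun V => by
    have := c.connecting_mono hK hP 0 ((c.syzygy n).obj V)
    exact mono_comp' (inferInstanceAs (Mono (α.hom.app V)))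
      (mono_comp' this (inferInstanceAs (Mono (e.hom.app (c.Ω.obj ((c.syzygy n).obj V))))))
  have hex := fun V => c.connecting_exact hK 0 ((c.syzygy n).obj V)
  have w : ∀ V, m.app V ≫ c.mapFromSyzygy F n V = 0 := fun V => by
    have h₁ : e.hom.app (c.Ω.obj ((c.syzygy n).obj V)) ≫ c.mapFromSyzygy F n V =
        homologyMap (K.map (c.ι ((c.syzygy n).obj V))) 0 ≫ e.hom.app _ :=
      (e.hom.naturality (c.ι ((c.syzygy n).obj V))).symm
    have h₂ : (c.connecting hK 0).app ((c.syzygy n).obj V) ≫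
        homologyMap (K.map (c.ι ((c.syzygy n).obj V))) 0 = 0 :=
      (hK _ (c.shortExact ((c.syzygy n).obj V))).δ_comp 1 0 (by simp)
    have h₃ := (c.connecting hK 0).app ((c.syzygy n).obj V) ≫= h₁
    have h₄ := (Category.assoc _ _ _).symm.trans ((h₂ =≫ e.hom.app _).trans zero_comp)
    refine (Category.assoc _ _ _).trans ((α.hom.app V ≫= ?_).trans comp_zero)
    exact (Category.assoc _ _ _).trans (h₃.trans h₄)
  refine nonempty_iso_of_exact (c.mapFromSyzygy F n) (c.leftDerivedToSyzygy F (n + 1)) m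
    (c.leftDerivedToSyzygy_map F n) w (c.leftDerivedToSyzygy_exact F n) fun V => ?_
  refine ShortComplex.exact_of_iso ?_ (hex V)
  refine ShortComplex.isoMk (α.symm.app V) (e.app _) (e.app _) ?_ ?_
  · simp only [Iso.app_hom, hm]
    exact α.inv_hom_id_app_assoc V _
  · exact (e.hom.naturality (c.ι ((c.syzygy n).obj V))).symm

end FunctorialCover

end CategoryTheory

/-! ### Free `FI`-modules on graded sets and the functorial free cover. -/

namespace FIModule

variable {R : Type u} [CommRing R]

/-- A pair of an element of a graded set, of degree `n` say, and an injection from the set with `n`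
elements to `X`. -/
structure Tuple (S : ℕ → Type u) (X : FI) where
  deg : ℕ
  label : S deg
  inj : FI.std deg ⟶ X

/-- The effect of an injection on tuples. -/
@[simps]
def Tuple.map {S : ℕ → Type u} {X Y : FI} (f : X ⟶ Y) (t : Tuple S X) : Tuple S Y :=
  ⟨t.deg, t.label, t.inj ≫ f⟩

/-- The free `FI`-module on a graded set. -/
def freeOn (R : Type u) [CommRing R] (S : ℕ → Type u) : FIModule R where
  obj X := ModuleCat.of R (Tuple S X →₀ R)
  map f := ModuleCat.ofHom (Finsupp.lmapDomain R R (Tuple.map f))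
  map_id X := by
    ext : 1
    refine Finsupp.lhom_ext' fun t => LinearMap.ext_ring ?_
    simp [Tuple.map]
  map_comp f g := by
    ext : 1
    refine Finsupp.lhom_ext' fun t => LinearMap.ext_ring ?_
    simp [Tuple.map]

/-- The basis element of a free `FI`-module given by a tuple. -/
def freeOnGen (R : Type u) [CommRing R] {S : ℕ → Type u} {X : FI} (t : Tuple S X) :
    (freeOn R S).obj X :=
  Finsupp.single t (1 : R)

theorem freeOn_map_freeOnGen {S : ℕ → Type u} {X Y : FI} (t : Tuple S X) (f : X ⟶ Y) :
    (freeOn R S).map f (freeOnGen R t) = freeOnGen R (t.map f) :=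
  Finsupp.mapDomain_single

theorem freeOn_linearMap_ext {S : ℕ → Type u} {X : FI} {N : Type*} [AddCommGroup N] [Module R N]
    {φ ψ : (freeOn R S).obj X →ₗ[R] N} (h : ∀ t, φ (freeOnGen R t) = ψ (freeOnGen R t)) :
    φ = ψ :=
  Finsupp.lhom_ext' fun t => LinearMap.ext_ring (h t)

/-- The morphism from a free `FI`-module determined by the images of the generators. -/
def freeOnLift {S : ℕ → Type u} (V : FIModule R) (v : ∀ n, S n → V.obj (FI.std n)) :
    freeOn R S ⟶ V where
  app X := ModuleCat.ofHom
    (Finsupp.linearCombination R fun t : Tuple S X => V.map t.inj (v t.deg t.label))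
  naturality X Y f := by
    ext : 1
    refine Finsupp.lhom_ext' fun t => LinearMap.ext_ring ?_
    simp only [freeOn, ModuleCat.hom_comp, ModuleCat.hom_ofHom, LinearMap.coe_comp,
      Function.comp_apply, Finsupp.lsingle_apply, Finsupp.lmapDomain_apply,
      Finsupp.mapDomain_single, Finsupp.linearCombination_single, one_smul]
    exact (map_map_apply V t.inj f _).symm

theorem freeOnLift_freeOnGen {S : ℕ → Type u} (V : FIModule R) (v : ∀ n, S n → V.obj (FI.std n))
    {X : FI} (t : Tuple S X) :
    (freeOnLift V v).app X (freeOnGen R t) = V.map t.inj (v t.deg t.label) :=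
  (Finsupp.linearCombination_single R 1 t).trans (one_smul R _)

/-- The generator of a free `FI`-module given by an element of the graded set. -/
def freeOnVar (R : Type u) [CommRing R] {S : ℕ → Type u} (n : ℕ) (s : S n) :
    (freeOn R S).obj (FI.std n) :=
  freeOnGen R ⟨n, s, 𝟙 _⟩

theorem freeOnLift_freeOnVar {S : ℕ → Type u} (V : FIModule R) (v : ∀ n, S n → V.obj (FI.std n))
    (n : ℕ) (s : S n) : (freeOnLift V v).app _ (freeOnVar R n s) = v n s := by
  refine (freeOnLift_freeOnGen V v _).trans ?_
  dsimp only
  rw [V.map_id]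
  rfl

theorem freeOn_hom_ext {S : ℕ → Type u} {V : FIModule R} {f g : freeOn R S ⟶ V}
    (h : ∀ n (s : S n), f.app _ (freeOnVar R n s) = g.app _ (freeOnVar R n s)) : f = g := by
  ext X : 3
  refine freeOn_linearMap_ext fun t => ?_
  have ht : freeOnGen R t = (freeOn R S).map t.inj (freeOnVar R t.deg t.label) := by
    rw [freeOnVar, freeOn_map_freeOnGen]
    rfl
  change f.app X (freeOnGen R t) = g.app X (freeOnGen R t)
  rw [ht, app_map_apply, app_map_apply, h]

/-- By the Yoneda lemma a map out of a free module is a free choice of elements, and an epimorphism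
is surjective at each finite set, so the chosen elements lift. -/
theorem freeOn_projective (S : ℕ → Type u) : Projective (freeOn R S) where
  factors {E W} f e _ := by
    have hs : ∀ n, Function.Surjective (e.app (FI.std n)) := fun n =>
      (ModuleCat.epi_iff_surjective _).1 inferInstance
    choose v hv using fun n (s : S n) => hs n (f.app _ (freeOnVar R n s))
    refine ⟨freeOnLift E v, freeOn_hom_ext fun n s => ?_⟩
    rw [NatTrans.comp_app, ModuleCat.comp_apply, freeOnLift_freeOnVar, hv]

/-- The free `FI`-module on the elements of an `FI`-module. -/
def freeCover (R : Type u) [CommRing R] : FIModule R ⥤ FIModule R where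
  -- All elements serve as generators: a chosen generating set would not be functorial.
  obj V := freeOn R fun n => V.obj (FI.std n)
  map {V W} η := freeOnLift _ fun n v => freeOnVar R n (η.app (FI.std n) v)
  map_id V := freeOn_hom_ext fun n s => by
    rw [freeOnLift_freeOnVar]
    rfl
  map_comp η θ := freeOn_hom_ext fun n s => by
    rw [NatTrans.comp_app, ModuleCat.comp_apply, freeOnLift_freeOnVar, freeOnLift_freeOnVar,
      freeOnLift_freeOnVar]
    rfl

/-- The projection of the free `FI`-module on the elements of an `FI`-module. -/
def freeCoverπ (R : Type u) [CommRing R] : freeCover R ⟶ 𝟭 (FIModule R) where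
  app V := freeOnLift V fun _ v => v
  naturality V W η := freeOn_hom_ext fun n s => by
    change (freeOnLift W fun _ w => w).app _ ((freeOnLift _ fun n v => freeOnVar R n
      (η.app (FI.std n) v)).app _ (freeOnVar R n s)) =
        η.app _ ((freeOnLift V fun _ v => v).app _ (freeOnVar R n s))
    rw [freeOnLift_freeOnVar, freeOnLift_freeOnVar, freeOnLift_freeOnVar]

theorem freeOnLift_surjective (V : FIModule R) (X : FI) :
    Function.Surjective
      ((freeOnLift (S := fun n => V.obj (FI.std n)) V fun _ v => v).app X) := by
  intro w
  obtain ⟨n, ⟨e⟩⟩ := Finite.exists_equiv_fin X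
  let α : FI.std n ⟶ X := ⟨e.symm, e.symm.injective⟩
  let β : X ⟶ FI.std n := ⟨e, e.injective⟩
  have hβα : β ≫ α = 𝟙 X := FI.hom_ext fun x => e.symm_apply_apply x
  refine ⟨freeOnGen R (S := fun n => V.obj (FI.std n)) ⟨n, V.map β w, α⟩, ?_⟩
  rw [freeOnLift_freeOnGen, map_map_apply, hβα, V.map_id]
  rfl

/-- The functorial cover of `FI`-modules by free modules. -/
def cover (R : Type u) [CommRing R] : FunctorialCover (FIModule R) :=
  FunctorialCover.ofEpi (freeCover R) (freeCoverπ R) (fun _ => freeOn_projective _) fun V =>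
    have : ∀ X, Epi (((freeCoverπ R).app V).app X) := fun X =>
      (ModuleCat.epi_iff_surjective _).2 (freeOnLift_surjective V X)
    NatTrans.epi_of_epi_app _

end FIModule

/-! ### Exactness of the Koszul complex as a functor. -/

theorem CategoryTheory.ShortComplex.exact_of_evaluation {T : Type*} [Category* T] {A : Type*}
    [Category* A] [Abelian A] (S : ShortComplex (T ⥤ A))
    (h : ∀ X, (S.map ((evaluation T A).obj X)).Exact) : S.Exact := by
  rw [ShortComplex.exact_iff_isZero_homology, Functor.isZero_iff]
  intro X
  exact ((ShortComplex.exact_iff_isZero_homology _).1 (h X)).of_iso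
    (S.mapHomologyIso ((evaluation T A).obj X)).symm

theorem CategoryTheory.ShortComplex.shortExact_of_evaluation {T : Type*} [Category* T] {A : Type*}
    [Category* A] [Abelian A] (S : ShortComplex (T ⥤ A))
    (h : ∀ X, (S.map ((evaluation T A).obj X)).ShortExact) : S.ShortExact where
  exact := S.exact_of_evaluation fun X => (h X).exact
  mono_f := by
    have : ∀ X, Mono (S.f.app X) := fun X => (h X).mono_f
    exact NatTrans.mono_of_mono_app _
  epi_g := by
    have : ∀ X, Epi (S.g.app X) := fun X => (h X).epi_g
    exact NatTrans.epi_of_epi_app _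

theorem DirectSum.lmap_exact {R ι : Type*} [Semiring R] {L M N : ι → Type*}
    [∀ i, AddCommMonoid (L i)] [∀ i, Module R (L i)] [∀ i, AddCommMonoid (M i)]
    [∀ i, Module R (M i)] [∀ i, AddCommMonoid (N i)] [∀ i, Module R (N i)]
    {f : ∀ i, L i →ₗ[R] M i} {g : ∀ i, M i →ₗ[R] N i}
    (h : ∀ i, Function.Exact (f i) (g i)) :
    Function.Exact (DirectSum.lmap f) (DirectSum.lmap g) := by
  have h' : ∀ i, LinearMap.ker (g i) = LinearMap.range (f i) := fun i =>
    LinearMap.exact_iff.1 (h i)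
  rw [LinearMap.exact_iff, DirectSum.ker_lmap, DirectSum.range_lmap]
  simp only [h']

namespace FIModule

variable {R : Type u} [CommRing R]

theorem koszulApp_eq_lmap {V W : FIModule R} (η : V ⟶ W) (X : FI) (a : ℕ) :
    koszulApp η X a = DirectSum.lmap fun I : Index X a =>
      LinearMap.rTensor (Det R I) (η.app (FI.compl I.set)).hom := by
  refine DirectSum.linearMap_ext R fun I => LinearMap.ext fun x => ?_
  rw [LinearMap.comp_apply, LinearMap.comp_apply, koszulApp, DirectSum.toModule_lof,
    DirectSum.lmap_lof]
  rfl

theorem shortExact_app {S : ShortComplex (FIModule R)} (hS : S.ShortExact) (X : FI) :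
    (S.map ((evaluation FI (ModuleCat.{u} R)).obj X)).ShortExact :=
  hS.map_of_exact _

instance : (koszulFunctor R).Additive where
  map_add {V W f g} := by
    ext a X : 4
    refine koszulTerm_hom_ext fun I e _ v => ?_
    refine (koszulApp_gen (f + g) I e v).trans ?_
    refine Eq.trans ?_ (congrArg₂ (· + ·) (koszulApp_gen f I e v) (koszulApp_gen g I e v)).symm
    change gen W I e (f.app _ v + g.app _ v) = _
    rw [gen, TensorProduct.add_tmul, map_add]
    rfl

theorem koszulFunctor_shortExact (S : ShortComplex (FIModule R)) (hS : S.ShortExact) :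
    (S.map (koszulFunctor R)).ShortExact := by
  refine HomologicalComplex.shortExact_of_degreewise_shortExact _ fun a =>
    ShortComplex.shortExact_of_evaluation _ fun X => ?_
  have hI : ∀ I : Index X a, _ := fun I => shortExact_app hS (FI.compl I.set)
  have hf : ∀ I : Index X a, Function.Injective (S.f.app (FI.compl I.set)).hom := fun I =>
    (ModuleCat.mono_iff_injective _).1 (hI I).mono_f
  have hg : ∀ I : Index X a, Function.Surjective (S.g.app (FI.compl I.set)).hom := fun I =>
    (ModuleCat.epi_iff_surjective _).1 (hI I).epi_g
  have hfg : ∀ I : Index X a, Function.Exact (S.f.app (FI.compl I.set)).hom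
      (S.g.app (FI.compl I.set)).hom := fun I =>
    (ShortComplex.ShortExact.moduleCat_exact_iff_function_exact _).1 (hI I).exact
  refine
    { exact := (ShortComplex.ShortExact.moduleCat_exact_iff_function_exact _).2 ?_
      mono_f := (ModuleCat.mono_iff_injective _).2 ?_
      epi_g := (ModuleCat.epi_iff_surjective _).2 ?_ }
  · change Function.Exact (koszulApp S.f X a) (koszulApp S.g X a)
    rw [koszulApp_eq_lmap, koszulApp_eq_lmap]
    exact DirectSum.lmap_exact fun I => rTensor_exact _ (hfg I) (hg I)
  · change Function.Injective (koszulApp S.f X a)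
    rw [koszulApp_eq_lmap]
    -- Injectivity is where the flatness of `det I` enters; the rest is right exactness of the
    -- tensor product.
    exact (DirectSum.lmap_injective _).2 fun I =>
      Module.Flat.rTensor_preserves_injective_linearMap _ (hf I)
  · change Function.Surjective (koszulApp S.g X a)
    rw [koszulApp_eq_lmap]
    exact (DirectSum.lmap_surjective _).2 fun I => LinearMap.rTensor_surjective _ (hg I)

/-! ### Koszul homology in degree zero. -/

/-- The inclusion of the complement of a subset. -/
def complToSelf {X : FI} (I : Set X) : FI.compl I ⟶ X :=
  ⟨Subtype.val, Subtype.val_injective⟩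

/-- The identification of the Koszul complex in degree zero with the module itself. -/
def koszulZeroTo (V : FIModule R) (X : FI) : KoszulTerm V X 0 →ₗ[R] V.obj X :=
  DirectSum.toModule R _ _ fun I =>
    (TensorProduct.rid R (V.obj X)).toLinearMap ∘ₗ
      TensorProduct.map (V.map (complToSelf I.set)).hom
        (exteriorPower.zeroEquiv R (I.set →₀ R)).toLinearMap

theorem koszulZeroTo_gen (V : FIModule R) {X : FI} (I : Index X 0) (f : Fin 0 → I.set)
    (v : V.obj (FI.compl I.set)) :
    koszulZeroTo V X (gen V I f v) = V.map (complToSelf I.set) v := by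
  rw [gen, koszulZeroTo, DirectSum.toModule_lof, LinearMap.comp_apply, TensorProduct.map_tmul]
  simp

/-- The empty subset. -/
abbrev emptyIndex (X : FI) : Index X 0 := ⟨∅, Set.ncard_empty _⟩

/-- The identity of a set, as a map to the complement of the empty subset. -/
def toComplEmpty (X : FI) : X ⟶ FI.compl (emptyIndex X).set :=
  ⟨fun x => ⟨x, Set.notMem_empty x⟩, fun _ _ e => congrArg Subtype.val e⟩

theorem koszulZeroTo_surjective (V : FIModule R) (X : FI) :
    Function.Surjective (koszulZeroTo V X) := fun v => by
  refine ⟨gen V (emptyIndex X) Fin.elim0 (V.map (toComplEmpty X) v), ?_⟩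
  rw [koszulZeroTo_gen, map_map_apply]
  change V.map (𝟙 X) v = v
  rw [V.map_id]
  rfl

theorem gen_zero_eq (V : FIModule R) {X : FI} (I : Index X 0) (f : Fin 0 → I.set)
    (v : V.obj (FI.compl I.set)) :
    gen V (emptyIndex X) Fin.elim0 (V.map (toComplEmpty X) (V.map (complToSelf I.set) v)) =
      gen V I f v := by
  have hI : I.set = ∅ := (Set.ncard_eq_zero (Set.toFinite _)).1 I.card
  rw [map_map_apply]
  have h := gen_congr V (I := emptyIndex X) (I' := I) hI.symm (f := Fin.elim0) (f' := f)
    (fun p => p.elim0) (g := complToSelf I.set ≫ toComplEmpty X) (g' := 𝟙 _) (fun _ => rfl) v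
  refine h.trans ?_
  rw [V.map_id]
  rfl

theorem koszulZeroTo_injective (V : FIModule R) (X : FI) :
    Function.Injective (koszulZeroTo V X) := by
  let ψ : V.obj X →ₗ[R] KoszulTerm V X 0 :=
    DirectSum.lof R (Index X 0) (fun I => Summand V I) (emptyIndex X) ∘ₗ
      ((TensorProduct.mk R _ (Det R (emptyIndex X))).flip
        (exteriorPower.ιMulti R 0 fun p => vec R (Fin.elim0 p))) ∘ₗ (V.map (toComplEmpty X)).hom
  have h : ψ ∘ₗ koszulZeroTo V X = LinearMap.id := by
    refine koszulTerm_hom_ext fun I f _ v => ?_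
    rw [LinearMap.comp_apply, koszulZeroTo_gen]
    exact gen_zero_eq V I f v
  exact Function.LeftInverse.injective (g := ψ) fun x => LinearMap.congr_fun h x

theorem koszulZeroTo_koszulD_gen (V : FIModule R) {X : FI} (I : Index X 1) (f : Fin 1 → I.set)
    (v : V.obj (FI.compl I.set)) :
    koszulZeroTo V X (koszulD V X 0 (gen V I f v)) = -V.map (complToSelf I.set) v := by
  rw [koszulD_gen V I f (Function.injective_of_subsingleton f), map_sum, Fin.sum_univ_one,
    map_smul, koszulZeroTo_gen, map_map_apply]
  simp only [Fin.val_zero, zero_add, pow_one, neg_smul, one_smul]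
  rfl

/-- The complement of a point is smaller than `X`. Conversely, an injection from a smaller set
misses some point `x` and so factors through the complement of `x`. -/
theorem range_koszulZeroTo_koszulD (V : FIModule R) (X : FI) :
    LinearMap.range (koszulZeroTo V X ∘ₗ koszulD V X 0) = J V X := by
  refine le_antisymm ?_ (Submodule.span_le.2 ?_)
  · suffices h : (J V X).mkQ ∘ₗ koszulZeroTo V X ∘ₗ koszulD V X 0 = 0 by
      rw [← LinearMap.range_le_ker_iff, Submodule.ker_mkQ] at h
      exact h
    refine koszulTerm_hom_ext fun I f _ v => ?_
    rw [LinearMap.comp_apply, LinearMap.comp_apply, koszulZeroTo_koszulD_gen, map_neg,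
      LinearMap.zero_apply, neg_eq_zero, Submodule.mkQ_apply, Submodule.Quotient.mk_eq_zero]
    refine Submodule.subset_span ⟨_, complToSelf I.set, v, ?_, rfl⟩
    have h := Set.ncard_add_ncard_compl I.set
    rw [I.card] at h
    change (I.setᶜ).ncard < _
    omega
  · rintro _ ⟨Y, α, v, hY, rfl⟩
    obtain ⟨x, hx⟩ : ∃ x, x ∉ Set.range α.toFun := by
      by_contra! h
      exact hY.not_ge (Nat.card_le_card_of_surjective α.toFun fun x => h x)
    let I : Index X 1 := ⟨{x}, Set.ncard_singleton x⟩
    let β : Y ⟶ FI.compl I.set :=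
      ⟨fun y => ⟨α.toFun y, fun h => hx ⟨y, h⟩⟩,
        fun _ _ e => α.injective (congrArg Subtype.val e)⟩
    -- The minus sign compensates the sign `(-1) ^ 1` of the differential.
    refine ⟨gen V I (fun _ => ⟨x, rfl⟩) (-V.map β v), ?_⟩
    rw [LinearMap.comp_apply, koszulZeroTo_koszulD_gen, map_neg, neg_neg, map_map_apply]
    rfl

/-- The projection from the degree zero term of the Koszul complex of `V` to `V / JV`. -/
def koszulModuleAug (V : FIModule R) : koszulModule V 0 ⟶ modJ V where
  app X := ModuleCat.ofHom ((J V X).mkQ ∘ₗ koszulZeroTo V X)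
  naturality X Y α := by
    ext : 1
    refine koszulTerm_hom_ext fun I f _ v => ?_
    change (J V Y).mkQ (koszulZeroTo V Y (koszulMap V α 0 (gen V I f v))) =
      (J V Y).mkQ (V.map α (koszulZeroTo V X (gen V I f v)))
    rw [koszulMap_gen, koszulZeroTo_gen, koszulZeroTo_gen, map_map_apply, map_map_apply]
    rfl

/-- The augmentation of the Koszul complex. -/
def koszulAug (V : FIModule R) : (koszulComplex V).X 0 ⟶ (modJFunctor R).obj V :=
  koszulModuleAug V

theorem koszulD_koszulAug_exact (V : FIModule R) (X : FI) :
    Function.Exact (koszulD V X 0) ((J V X).mkQ ∘ₗ koszulZeroTo V X) := by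
  intro z
  rw [LinearMap.comp_apply, Submodule.mkQ_apply, Submodule.Quotient.mk_eq_zero,
    ← range_koszulZeroTo_koszulD]
  constructor
  · rintro ⟨y, hy⟩
    exact ⟨y, koszulZeroTo_injective V X hy⟩
  · rintro ⟨y, rfl⟩
    exact ⟨y, rfl⟩

theorem d_koszulAug (V : FIModule R) : (koszulComplex V).d 1 0 ≫ koszulAug V = 0 := by
  have h : koszulDifferential V 0 ≫ koszulModuleAug V = 0 := by
    ext X : 3
    exact LinearMap.ext fun z => (koszulD_koszulAug_exact V X _).2 ⟨z, rfl⟩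
  rw [koszulComplex_d]
  exact h

theorem d_koszulAug_exact (V : FIModule R) :
    (ShortComplex.mk _ _ (d_koszulAug V)).Exact := by
  refine ShortComplex.exact_of_evaluation _ fun X =>
    (ShortComplex.ShortExact.moduleCat_exact_iff_function_exact _).2 ?_
  have h : (((koszulComplex V).d 1 0).app X).hom = koszulD V X 0 := by
    rw [koszulComplex_d]
    rfl
  change Function.Exact (((koszulComplex V).d 1 0).app X).hom ((J V X).mkQ ∘ₗ koszulZeroTo V X)
  rw [h]
  exact koszulD_koszulAug_exact V X

instance (V : FIModule R) : Epi (koszulAug V) := by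
  have : ∀ X, Epi ((koszulModuleAug V).app X) := fun X => (ModuleCat.epi_iff_surjective _).2
    ((Submodule.mkQ_surjective _).comp (koszulZeroTo_surjective V X))
  exact NatTrans.epi_of_epi_app (koszulModuleAug V)

/-- The map from the opcycles of the Koszul complex in degree zero. -/
def koszulOpcyclesTo (V : FIModule R) : (koszulComplex V).opcycles 0 ⟶ (modJFunctor R).obj V :=
  (koszulComplex V).descOpcycles (koszulAug V) 1 (by simp) (d_koszulAug V)

theorem p_koszulOpcyclesTo (V : FIModule R) :
    (koszulComplex V).pOpcycles 0 ≫ koszulOpcyclesTo V = koszulAug V :=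
  HomologicalComplex.p_descOpcycles _ _ _ _ _

instance (V : FIModule R) : IsIso (koszulOpcyclesTo V) :=
  isIso_descOpcycles_of_exact _ _ _ _ (d_koszulAug_exact V)

theorem koszulAug_naturality {V W : FIModule R} (η : V ⟶ W) :
    (koszulComplexMap η).f 0 ≫ koszulAug W = koszulAug V ≫ (modJFunctor R).map η := by
  ext X : 3
  refine koszulTerm_hom_ext fun I f _ v => ?_
  change (J W X).mkQ (koszulZeroTo W X (koszulApp η X 0 (gen V I f v))) =
    (J W X).mkQ (η.app X (koszulZeroTo V X (gen V I f v)))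
  rw [koszulApp_gen, koszulZeroTo_gen, koszulZeroTo_gen, app_map_apply]

theorem koszulOpcyclesTo_naturality {V W : FIModule R} (η : V ⟶ W) :
    HomologicalComplex.opcyclesMap (koszulComplexMap η) 0 ≫ koszulOpcyclesTo W =
      koszulOpcyclesTo V ≫ (modJFunctor R).map η := by
  rw [← cancel_epi ((koszulComplex V).pOpcycles 0), HomologicalComplex.p_opcyclesMap_assoc,
    p_koszulOpcyclesTo, koszulAug_naturality, reassoc_of% p_koszulOpcyclesTo]

/-- The homology of the Koszul complex in degree zero. -/
def koszulHomologyZeroIso (R : Type u) [CommRing R] : koszulHomology R 0 ≅ modJFunctor R :=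
  NatIso.ofComponents
    (fun V => (koszulComplex V).isoHomologyι₀ ≪≫ asIso (koszulOpcyclesTo V)) fun {V W} η => by
    have h := HomologicalComplex.homologyι_naturality (koszulComplexMap η) 0 =≫ koszulOpcyclesTo W
    rw [Category.assoc, Category.assoc, koszulOpcyclesTo_naturality, ← Category.assoc] at h
    exact (Category.assoc _ _ _).symm.trans (h.trans (by rfl))

/-! ### Acyclicity of the Koszul complex of a free module. -/

/-- The subset of `X` enumerated by an injective sequence. -/
abbrev rangeIndex {X : FI} {a : ℕ} (f : Fin a → X) (hf : Function.Injective f) : Index X a :=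
  ⟨Set.range f, by
    rw [← Set.image_univ, Set.ncard_image_of_injective _ hf, Set.ncard_univ, Nat.card_fin]⟩

/-- A map `T → X` whose image is disjoint from a subset, as a map to the complement. -/
def restrictCompl {X T : FI} (g : T ⟶ X) (I : Set X) (h : ∀ y, g.toFun y ∉ I) :
    T ⟶ FI.compl I :=
  ⟨fun y => ⟨g.toFun y, h y⟩, fun _ _ e => g.injective (congrArg Subtype.val e)⟩

open Classical in
/-- The element `g(v) ⊗ f 0 ∧ ⋯ ∧ f (a - 1)`, for a sequence `f` of elements of `X` and a map
`g : T → X`; it is zero if `f` is not injective or meets the image of `g`. -/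
def symb (V : FIModule R) {X T : FI} {a : ℕ} (f : Fin a → X) (g : T ⟶ X) (v : V.obj T) :
    KoszulTerm V X a :=
  if h : Function.Injective f ∧ ∀ y, g.toFun y ∉ Set.range f then
    gen V (rangeIndex f h.1) (fun p => ⟨f p, p, rfl⟩) (V.map (restrictCompl g _ h.2) v)
  else 0

theorem symb_of_not_injective (V : FIModule R) {X T : FI} {a : ℕ} {f : Fin a → X}
    (hf : ¬Function.Injective f) (g : T ⟶ X) (v : V.obj T) : symb V f g v = 0 :=
  dif_neg fun h => hf h.1

/-- An injective sequence of length `a` in `I` enumerates `I`, so the index set can be recovered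
from the sequence. Symbols thus avoid types depending on `I`. -/
theorem gen_eq_symb (V : FIModule R) {X T : FI} {a : ℕ} (I : Index X a) (f : Fin a → I.set)
    (hf : Function.Injective f) (g : T ⟶ FI.compl I.set) (v : V.obj T) :
    gen V I f (V.map g v) = symb V (fun p => (f p).1) (g ≫ complToSelf I.set) v := by
  have hinj : Function.Injective fun p => (f p).1 := Subtype.val_injective.comp hf
  have hr : Set.range (fun p => (f p).1) = I.set := by
    refine Set.eq_of_subset_of_ncard_le (Set.range_subset_iff.2 fun p => (f p).2) ?_
      (Set.toFinite _)
    rw [I.card, (rangeIndex _ hinj).card]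
  have hg : ∀ y, (g ≫ complToSelf I.set).toFun y ∉ Set.range fun p => (f p).1 := fun y => by
    rw [hr]
    exact (g.toFun y).2
  rw [symb, dif_pos ⟨hinj, hg⟩]
  exact gen_congr V (I' := rangeIndex _ hinj) hr.symm (fun _ => rfl) (fun _ => rfl) v

theorem koszulD_symb (V : FIModule R) {X T : FI} {a : ℕ} (f : Fin (a + 1) → X)
    (hf : Function.Injective f) (g : T ⟶ X) (hg : ∀ y, g.toFun y ∉ Set.range f) (v : V.obj T) :
    koszulD V X a (symb V f g v) =
      ∑ p : Fin (a + 1), (-1 : R) ^ (p.val + 1) • symb V (fun q => f (p.succAbove q)) g v := by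
  rw [symb, dif_pos ⟨hf, hg⟩, koszulD_gen V _ _ fun _ _ e => hf (congrArg Subtype.val e)]
  refine Finset.sum_congr rfl fun p _ => ?_
  rw [map_map_apply, gen_eq_symb]
  · rfl
  · exact fun _ _ e => Fin.succAbove_right_injective (hf (congrArg Subtype.val e))

theorem symb_comp_perm (V : FIModule R) {X T : FI} {a : ℕ} (f : Fin a → X) (g : T ⟶ X)
    (v : V.obj T) (σ : Equiv.Perm (Fin a)) :
    symb V (f ∘ σ) g v = ((Equiv.Perm.sign σ : ℤ) : R) • symb V f g v := by
  by_cases h : Function.Injective f ∧ ∀ y, g.toFun y ∉ Set.range f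
  · have h' := gen_eq_symb V (rangeIndex f h.1) (fun p => ⟨f (σ p), σ p, rfl⟩)
      (fun _ _ e => σ.injective (h.1 (congrArg Subtype.val e))) (restrictCompl g _ h.2) v
    refine h'.symm.trans ?_
    rw [symb, dif_pos h, gen, gen, ← map_smul, ← TensorProduct.tmul_smul]
    congr 2
    refine ((exteriorPower.ιMulti R a).map_perm
      (fun p => vec R (⟨f p, p, rfl⟩ : (rangeIndex f h.1).set)) σ).trans ?_
    rw [Units.smul_def, Int.cast_smul_eq_zsmul]
  · have h' : ¬(Function.Injective (f ∘ σ) ∧ ∀ y, g.toFun y ∉ Set.range (f ∘ σ)) := by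
      rwa [σ.injective_comp, σ.surjective.range_comp]
    rw [symb, symb, dif_neg h, dif_neg h', smul_zero]

/-- Moving entry `p` to the front is a cycle of length `p + 1`, of sign `(-1) ^ p`. -/
theorem symb_cons_succAbove (V : FIModule R) {X T : FI} {a : ℕ} (f : Fin (a + 1) → X) (g : T ⟶ X)
    (v : V.obj T) (p : Fin (a + 1)) :
    symb V (Fin.cons (f p) fun q => f (p.succAbove q)) g v =
      (-1 : R) ^ p.val • symb V f g v := by
  have h : (Fin.cons (f p) fun q => f (p.succAbove q) : Fin (a + 1) → X) =
      f ∘ p.cycleRange.symm :=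
    Fin.cons_removeNth_eq_comp_cycleRange_symm f p
  rw [h, symb_comp_perm, Equiv.Perm.sign_symm, Fin.sign_cycleRange]
  simp

/-- The subset obtained by adding an element. -/
abbrev Index.insert {X : FI} {a : ℕ} (I : Index X a) (x : X) (hx : x ∉ I.set) :
    Index X (a + 1) :=
  ⟨Insert.insert x I.set, by rw [Set.ncard_insert_of_notMem hx, I.card]⟩

/-- The map `det I → det (I ∪ {x})` given by the wedge product with `x` on the left. -/
def wedge (R : Type u) [CommRing R] {X : FI} {a : ℕ} (I : Index X a) (x : X) (hx : x ∉ I.set) :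
    Det R I →ₗ[R] Det R (I.insert x hx) :=
  exteriorPower.alternatingMapLinearEquiv
    (((exteriorPower.ιMulti R (a + 1)).curryLeft
      (vec R (⟨x, Set.mem_insert _ _⟩ : (I.insert x hx).set))).compLinearMap
        (Finsupp.lmapDomain R R fun i : I.set =>
          (⟨i.1, Set.mem_insert_of_mem _ i.2⟩ : (I.insert x hx).set)))

theorem wedge_ιMulti {X : FI} {a : ℕ} (I : Index X a) (x : X) (hx : x ∉ I.set)
    (f : Fin a → I.set) :
    wedge R I x hx (exteriorPower.ιMulti R a fun p => vec R (f p)) =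
      exteriorPower.ιMulti R (a + 1) fun p => vec R ((Fin.cons ⟨x, Set.mem_insert _ _⟩
        fun q => ⟨(f q).1, Set.mem_insert_of_mem _ (f q).2⟩ :
          Fin (a + 1) → (I.insert x hx).set) p) := by
  rw [wedge, exteriorPower.alternatingMapLinearEquiv_apply_ιMulti]
  change exteriorPower.ιMulti R (a + 1) _ = _
  congr 1
  ext p : 1
  refine Fin.cases ?_ (fun q => ?_) p
  · rfl
  · simp [vec]

open Classical in
/-- The map `w ↦ g(v) ⊗ x ∧ w` from `det I` to the Koszul complex. -/
def cone (V : FIModule R) {X T : FI} {a : ℕ} (I : Index X a) (g : T ⟶ FI.compl I.set)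
    (v : V.obj T) (x : X) (hx : ∀ y, (g ≫ complToSelf I.set).toFun y ≠ x) :
    Det R I →ₗ[R] KoszulTerm V X (a + 1) :=
  if h : x ∉ I.set then
    DirectSum.lof R (Index X (a + 1)) (fun K => Summand V K) (I.insert x h) ∘ₗ
      TensorProduct.mk R _ (Det R (I.insert x h)) (V.map (restrictCompl (g ≫ complToSelf I.set) _
        fun y hy => hy.elim (hx y) (g.toFun y).2) v) ∘ₗ wedge R I x h
  else 0

theorem cone_ιMulti (V : FIModule R) {X T : FI} {a : ℕ} (I : Index X a)
    (g : T ⟶ FI.compl I.set) (v : V.obj T) (x : X) (hx : ∀ y, (g ≫ complToSelf I.set).toFun y ≠ x)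
    (f : Fin a → I.set) (hf : Function.Injective f) :
    cone V I g v x hx (exteriorPower.ιMulti R a fun p => vec R (f p)) =
      symb V (Fin.cons x fun p => (f p).1) (g ≫ complToSelf I.set) v := by
  by_cases h : x ∉ I.set
  · rw [cone, dif_pos h, LinearMap.comp_apply, LinearMap.comp_apply, wedge_ιMulti]
    refine (gen_eq_symb V (I.insert x h) _ ?_ _ v).trans ?_
    · rw [Fin.cons_injective_iff]
      refine ⟨?_, fun _ _ e => hf (Subtype.ext (congrArg (fun z => z.1) e))⟩
      rintro ⟨p, hp⟩
      have hp' : (f p).1 = x := congrArg (fun z => z.1) hp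
      exact h (hp' ▸ (f p).2)
    · congr 1
      ext p
      refine Fin.cases ?_ (fun q => ?_) p <;> rfl
  · rw [cone, dif_neg h, LinearMap.zero_apply, symb_of_not_injective]
    rw [Fin.cons_injective_iff]
    rintro ⟨hp, -⟩
    -- If `x` lies in `I`, it already occurs in `f`, which exhausts `I`; the wedge product then has
    -- a repeated entry.
    have hbij : Function.Bijective f := (Nat.bijective_iff_injective_and_card f).2
      ⟨hf, by rw [Nat.card_coe_set_eq, I.card, Nat.card_fin]⟩
    obtain ⟨p, hp'⟩ := hbij.2 ⟨x, not_not.1 h⟩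
    exact hp ⟨p, congrArg Subtype.val hp'⟩

open Classical in
/-- The restriction of the contracting homotopy to a summand. -/
def homotopySummand (R : Type u) [CommRing R] (S : ℕ → Type u) {X : FI} {a : ℕ} (I : Index X a) :
    (freeOn R S).obj (FI.compl I.set) →ₗ[R] Det R I →ₗ[R] KoszulTerm (freeOn R S) X (a + 1) :=
  -- The chosen point depends only on the composite injection into `X`, which the differential
  -- preserves, and not on `I`. It fails to exist only if that injection is onto, which forces `I`
  -- to be empty; the value `0` then affects degree zero alone.
  Finsupp.linearCombination R fun t : Tuple S (FI.compl I.set) =>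
    if h : ∃ x, ∀ y, (t.inj ≫ complToSelf I.set).toFun y ≠ x then
      cone (freeOn R S) I t.inj (freeOnVar R t.deg t.label) h.choose h.choose_spec
    else 0

theorem homotopySummand_freeOnGen {S : ℕ → Type u} {X : FI} {a : ℕ} (I : Index X a)
    (t : Tuple S (FI.compl I.set)) (h : ∃ x, ∀ y, (t.inj ≫ complToSelf I.set).toFun y ≠ x) :
    homotopySummand R S I (freeOnGen R t) =
      cone (freeOn R S) I t.inj (freeOnVar R t.deg t.label) h.choose h.choose_spec :=
  (Finsupp.linearCombination_single R 1 t).trans ((one_smul R _).trans (dif_pos h))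

/-- The contracting homotopy of the Koszul complex of a free `FI`-module. -/
def homotopy (R : Type u) [CommRing R] (S : ℕ → Type u) (X : FI) (a : ℕ) :
    KoszulTerm (freeOn R S) X a →ₗ[R] KoszulTerm (freeOn R S) X (a + 1) :=
  DirectSum.toModule R _ _ fun I => TensorProduct.lift (homotopySummand R S I)

theorem freeOnGen_eq {S : ℕ → Type u} {X : FI} (t : Tuple S X) :
    freeOnGen R t = (freeOn R S).map t.inj (freeOnVar R t.deg t.label) := by
  rw [freeOnVar, freeOn_map_freeOnGen]
  rfl

theorem koszulTerm_freeOn_hom_ext {S : ℕ → Type u} {X : FI} {a : ℕ} {N : Type*} [AddCommGroup N]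
    [Module R N] {φ ψ : KoszulTerm (freeOn R S) X a →ₗ[R] N}
    (h : ∀ (f : Fin a → X), Function.Injective f → ∀ t : Tuple S X,
      (∀ y, t.inj.toFun y ∉ Set.range f) →
        φ (symb _ f t.inj (freeOnVar R t.deg t.label)) =
          ψ (symb _ f t.inj (freeOnVar R t.deg t.label))) : φ = ψ := by
  refine koszulTerm_hom_ext fun I f hf v => ?_
  let G : (freeOn R S).obj (FI.compl I.set) →ₗ[R] KoszulTerm (freeOn R S) X a :=
    DirectSum.lof R (Index X a) (fun I => Summand (freeOn R S) I) I ∘ₗ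
      (TensorProduct.mk R _ (Det R I)).flip (exteriorPower.ιMulti R a fun p => vec R (f p))
  suffices H : φ ∘ₗ G = ψ ∘ₗ G from LinearMap.congr_fun H v
  refine freeOn_linearMap_ext fun t => ?_
  have hG : G (freeOnGen R t) = symb _ (fun p => (f p).1) (t.inj ≫ complToSelf I.set)
      (freeOnVar R t.deg t.label) := by
    rw [freeOnGen_eq]
    exact gen_eq_symb _ I f hf t.inj _
  refine (congrArg φ hG).trans (Eq.trans ?_ (congrArg ψ hG).symm)
  refine h _ (Subtype.val_injective.comp hf) (t.map (complToSelf I.set)) ?_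
  rintro y ⟨p, hp⟩
  have hp' : (f p).1 = (t.inj.toFun y).1 := hp
  exact (t.inj.toFun y).2 (hp' ▸ (f p).2)

theorem homotopy_symb {S : ℕ → Type u} {X : FI} {a : ℕ} (f : Fin a → X)
    (hf : Function.Injective f) (t : Tuple S X) (ht : ∀ y, t.inj.toFun y ∉ Set.range f)
    (h : ∃ x, ∀ y, t.inj.toFun y ≠ x) :
    homotopy R S X a (symb _ f t.inj (freeOnVar R t.deg t.label)) =
      symb _ (Fin.cons h.choose f) t.inj (freeOnVar R t.deg t.label) := by
  rw [symb, dif_pos ⟨hf, ht⟩, homotopy, gen, DirectSum.toModule_lof, TensorProduct.lift.tmul,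
    ← freeOnGen_eq ⟨t.deg, t.label, restrictCompl t.inj _ ht⟩, homotopySummand_freeOnGen _ _ h]
  exact cone_ιMulti _ (rangeIndex f hf) _ _ _ _ _
    fun _ _ e => hf (congrArg Subtype.val e)

/-- This is the usual cone contraction `w ↦ x ∧ w`. The sum is minus the identity because the
differential removes the leading entry with sign `-1`. -/
theorem koszulD_homotopy (S : ℕ → Type u) (X : FI) (a : ℕ) :
    koszulD (freeOn R S) X (a + 1) ∘ₗ homotopy R S X (a + 1) +
      homotopy R S X a ∘ₗ koszulD (freeOn R S) X a = -LinearMap.id := by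
  refine koszulTerm_freeOn_hom_ext fun f hf t ht => ?_
  -- Positive degree guarantees a point outside the image: any entry of `f` is one.
  have h : ∃ x, ∀ y, t.inj.toFun y ≠ x := ⟨f 0, fun y hy => ht y ⟨0, hy.symm⟩⟩
  have hx := h.choose_spec
  have hd : homotopy R S X a (koszulD (freeOn R S) X a
      (symb _ f t.inj (freeOnVar R t.deg t.label))) = ∑ p : Fin (a + 1), (-1 : R) ^ (p.val + 1) •
        symb (freeOn R S) (Fin.cons h.choose fun q => f (p.succAbove q)) t.inj
          (freeOnVar R t.deg t.label) := by
    rw [koszulD_symb _ f hf t.inj ht, map_sum]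
    refine Finset.sum_congr rfl fun p _ => ?_
    rw [map_smul, homotopy_symb (fun q => f (p.succAbove q))
      (hf.comp Fin.succAbove_right_injective) t _ h]
    rintro y ⟨q, hq⟩
    exact ht y ⟨_, hq⟩
  rw [LinearMap.add_apply, LinearMap.comp_apply, LinearMap.comp_apply, hd,
    homotopy_symb f hf t ht h, LinearMap.neg_apply, LinearMap.id_apply]
  generalize h.choose = x at hx
  generalize freeOnVar R t.deg t.label = v
  by_cases hxf : x ∈ Set.range f
  -- If `x = f p`, then `x ∧ f` vanishes, and so do all terms of the other composite that retain `f
  -- p`. The term omitting `f p` has total sign `(-1) ^ (p + 1) * (-1) ^ p = -1`.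
  · obtain ⟨p, rfl⟩ := hxf
    rw [symb_of_not_injective _ (f := Fin.cons (f p) f), map_zero, zero_add,
      Finset.sum_eq_single p, symb_cons_succAbove, smul_smul, ← pow_add]
    · rw [show p.val + 1 + p.val = 2 * p.val + 1 by ring, pow_succ, pow_mul]
      simp
    · intro q _ hq
      rw [symb_of_not_injective, smul_zero]
      rw [Fin.cons_injective_iff]
      obtain ⟨r, hr⟩ := Fin.exists_succAbove_eq hq.symm
      exact fun h => h.1 ⟨r, congrArg f hr⟩
    · exact fun h => absurd (Finset.mem_univ p) h
    · rw [Fin.cons_injective_iff]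
      exact fun h => h.1 ⟨p, rfl⟩
  -- Otherwise removing `x` from `x ∧ f` gives minus the original symbol. The remaining terms cancel
  -- in pairs, since the leading `x` shifts every position by one.
  · rw [koszulD_symb, Fin.sum_univ_succ, add_assoc, ← Finset.sum_add_distrib,
      Finset.sum_eq_zero, add_zero]
    · simp only [Fin.val_zero, zero_add, pow_one, Fin.zero_succAbove, Fin.cons_succ]
      exact (neg_smul (M := KoszulTerm (freeOn R S) X (a + 1)) 1 _).trans
        (congrArg _ (one_smul R _))
    · intro p _
      have e : (fun q => (Fin.cons x f : Fin (a + 2) → X) (p.succ.succAbove q)) =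
          Fin.cons x fun q => f (p.succAbove q) := by
        ext q
        refine Fin.cases ?_ (fun r => ?_) q <;> simp
      rw [e, ← add_smul, Fin.val_succ, pow_succ _ (p.val + 1)]
      simp
    · exact Fin.cons_injective_iff.2 ⟨hxf, hf⟩
    · rw [Fin.range_cons]
      rintro y (hy | hy)
      exacts [hx y hy, ht y hy]

theorem koszulD_freeOn_exact (S : ℕ → Type u) (X : FI) (a : ℕ) :
    Function.Exact (koszulD (freeOn R S) X (a + 1)) (koszulD (freeOn R S) X a) := by
  intro z
  refine ⟨fun hz => ⟨-homotopy R S X (a + 1) z, ?_⟩, ?_⟩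
  · have h := LinearMap.congr_fun (koszulD_homotopy (R := R) S X a) z
    rw [LinearMap.add_apply, LinearMap.comp_apply, LinearMap.comp_apply, hz, map_zero, add_zero,
      LinearMap.neg_apply, LinearMap.id_apply] at h
    rw [map_neg, h, neg_neg]
  · rintro ⟨y, rfl⟩
    exact LinearMap.congr_fun (koszulD_comp_koszulD _ X a) y

theorem koszulComplex_freeOn_exactAt (S : ℕ → Type u) (a : ℕ) :
    (koszulComplex (freeOn R S)).ExactAt (a + 1) := by
  rw [HomologicalComplex.exactAt_iff' _ (a + 1 + 1) (a + 1) a (by simp) (by simp)]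
  refine ShortComplex.exact_of_evaluation _ fun X =>
    (ShortComplex.ShortExact.moduleCat_exact_iff_function_exact _).2 ?_
  have h (n : ℕ) : (((koszulComplex (freeOn R S)).d (n + 1) n).app X).hom =
      koszulD (freeOn R S) X n := by
    rw [koszulComplex_d]
    rfl
  change Function.Exact (((koszulComplex (freeOn R S)).d (a + 1 + 1) (a + 1)).app X).hom
    (((koszulComplex (freeOn R S)).d (a + 1) a).app X).hom
  rw [h, h]
  exact koszulD_freeOn_exact S X a

end FIModule

end

theorem theorem1p1 (R : Type u) [CommRing R] (a : ℕ) :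
    Nonempty (FIModule.homology R a ≅ FIModule.koszulHomology R a) :=
  (FIModule.cover R).nonempty_leftDerived_iso FIModule.koszulFunctor_shortExact
    (fun n _ => (HomologicalComplex.exactAt_iff_isZero_homology _ _).1
      (FIModule.koszulComplex_freeOn_exactAt _ n))
    (FIModule.modJFunctor R) (FIModule.koszulHomologyZeroIso R) a
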